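/- **Theorem (The $L^2$-approximation error).** Let $d\in\mathbb N$ and, for $f\in L^2(\mathbb R^d)$ (complex valued), let $\hat f$ be the Fourier transform $\hat f(\xi)=(2\pi)^{-d/2}\int_{\mathbb R^d} f(x)e^{-i\langle \xi,x\rangle}\,dx$, extended from $L^1\cap L^2$ to $L^2(\mathbb R^d)$ by continuity. Let $\varphi\in L^2(\mathbb R^d)$ and $T,s>0$, put $$\varphi_{T,s}^k(x)=T^{-d/2}\,\varphi\!\left(\tfrac{x}{T}-sk\right)\quad(k\in\mathbb Z^d),\qquad \mathcal V_{T,s,\varphi}=\overline{\operatorname{span}\{\varphi_{T,s}^k: k\in\mathbb Z^d\}}\subseteq L^2(\mathbb R^d),$$ and let $\mathbf P_{T,s}$ be the orthogonal projection of $L^2(\mathbb R^d)$ onto $\mathcal V_{T,s,\varphi}$. Suppose that $(\varphi_{T,s}^k)_{k\in\mathbb Z^d}$ is a Riesz basis of $\mathcal V_{T,s,\varphi}$, i.e. there are $A,B>0$ such that for all $c\in\ell^2(\mathbb Z^d)$ the series $\sum_k c_k\varphi_{T,s}^k$ converges in $L^2$ and $A\|c\|_{\ell^2}^2\le\big\|\sum_k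 c_k\varphi_{T,s}^k\big\|_{L^2}^2\le B\|c\|_{\ell^2}^2$. Then $0<\sum_{k\in\mathbb Z^d}|\hat\varphi(\eta+2k\pi/s)|^2<\infty$ for almost every $\eta\in\mathbb R^d$, so that $$\mathcal E_\varphi(s,T\xi)=1-\frac{|\hat\varphi(T\xi)|^2}{\sum_{k\in\mathbb Z^d}|\hat\varphi(T\xi+2k\pi/s)|^2}$$ is defined for almost every $\xi\in\mathbb R^d$. Moreover, for every real $r>d/2$ and every $f$ in the Sobolev space $W_2^r(\mathbb R^d)$, normed by $\|f\|_{W_2^r}=\big(\int_{\mathbb R^d}(1+\|\xi\|^2)^r|\hat f(\xi)|^2\,d\xi\big)^{1/2}$, the following integral and series converge, and $$\|\mathbf P_{T,s}f-f\|_{L^2}=\left[\int_{[-\frac{\pi}{Ts},\frac{\pi}{Ts}]^d}|\hat f(\xi)|^2\,\mathcal E_\varphi(s,T\xi)\,d\xi\right]^{1/2}+\mathcal R,$$ where the remainder $\mathcal R\in\mathbb R$ satisfies $$|\mathcal R|\le\|f\|_{W_2^r}\left(\frac{Ts}{\pi}\right)^r\Bigg(\sum_{n\in\mathbb Z^d\setminus\{0\}}\frac1{\|n\|^{2r}}\Bigg)^{1/2}.$$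 Here $\|\cdot\|$ is the Euclidean norm on $\mathbb R^d$. -/

import Mathlib

open MeasureTheory FourierTransform
open scoped Real ENNReal

noncomputable section

namespace ShiftInvariant

/-- The Euclidean space `ℝ^d`. -/
abbrev Rd (d : ℕ) : Type := EuclideanSpace ℝ (Fin d)

/-- The complex Hilbert space `L²(ℝ^d)`, with respect to Lebesgue measure. -/
abbrev L2 (d : ℕ) : Type := Lp ℂ 2 (volume : Measure (Rd d))

/-- The lattice point `k ∈ ℤ^d`, seen as a vector of `ℝ^d`. -/
def latticePoint {d : ℕ} (k : Fin d → ℤ) : Rd d :=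
  WithLp.toLp 2 fun i => (k i : ℝ)

/-- The `L²` Fourier transform in the unitary, angular frequency convention,
`f̂(ξ) = (2π)^(-d/2) ∫ f(x) exp(-i ⟨ξ, x⟩) dx` for `f ∈ L¹ ∩ L²`, extended to `L²` by continuity.
Mathlib's `𝓕` on `L²` is the continuous extension of `ξ ↦ ∫ f(x) exp(-2πi ⟨ξ, x⟩) dx`, so that
`f̂(ξ) = (2π)^(-d/2) (𝓕 f)(ξ / (2π))`. -/
def fourierL2 {d : ℕ} (f : L2 d) (ξ : Rd d) : ℂ :=
  (((2 * π) ^ (-(d : ℝ) / 2) : ℝ) : ℂ) * (𝓕 f : L2 d) ((2 * π)⁻¹ • ξ)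

/-- The function `x ↦ T^(-d/2) φ(x / T - s k)`. -/
def generatorFun {d : ℕ} (φ : Rd d → ℂ) (T s : ℝ) (k : Fin d → ℤ) (x : Rd d) : ℂ :=
  ((T ^ (-(d : ℝ) / 2) : ℝ) : ℂ) * φ (T⁻¹ • x - s • latticePoint k)

theorem memLp_generatorFun {d : ℕ} (φ : L2 d) {T : ℝ} (hT : 0 < T) (s : ℝ) (k : Fin d → ℤ) :
    MemLp (generatorFun φ T s k) 2 (volume : Measure (Rd d)) := by
  have hshift : MemLp (fun y : Rd d => φ (y - s • latticePoint k)) 2 volume :=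
    (Lp.memLp φ).comp_measurePreserving (measurePreserving_sub_right volume _)
  have hmap := Measure.map_addHaar_smul (volume : Measure (Rd d)) (inv_ne_zero hT.ne')
  have hdil : MemLp (fun y : Rd d => φ (y - s • latticePoint k)) 2
      (Measure.map (T⁻¹ • ·) (volume : Measure (Rd d))) := by
    rw [hmap]
    exact hshift.smul_measure ENNReal.ofReal_ne_top
  exact (hdil.comp_of_map (measurable_const_smul T⁻¹).aemeasurable).const_mul _

/-- The family `φ_{T,s}^k ∈ L²(ℝ^d)`, `φ_{T,s}^k(x) = T^(-d/2) φ(x / T - s k)`, `k ∈ ℤ^d`. -/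
def generator {d : ℕ} (φ : L2 d) {T : ℝ} (hT : 0 < T) (s : ℝ) (k : Fin d → ℤ) : L2 d :=
  (memLp_generatorFun φ hT s k).toLp (generatorFun φ T s k)

/-- The shift-invariant space `V_{T,s,φ}`: the closed linear span in `L²(ℝ^d)` of the functions
`φ_{T,s}^k`, `k ∈ ℤ^d`. -/
abbrev shiftSpace {d : ℕ} (φ : L2 d) {T : ℝ} (hT : 0 < T) (s : ℝ) : Submodule ℂ (L2 d) :=
  (Submodule.span ℂ (Set.range (generator φ hT s))).topologicalClosure

/-- The family `v` is a Riesz basis of the closed subspace `V` of a Hilbert space: `V` is its closed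
linear span, and there are `A, B > 0` such that, for all `c ∈ ℓ²`, the series `∑ c_k v_k` converges
and `A ‖c‖² ≤ ‖∑ c_k v_k‖² ≤ B ‖c‖²`. -/
def IsRieszBasis {ι H : Type*} [NormedAddCommGroup H] [InnerProductSpace ℂ H]
    (v : ι → H) (V : Submodule ℂ H) : Prop :=
  (Submodule.span ℂ (Set.range v)).topologicalClosure = V ∧
    ∃ A B : ℝ, 0 < A ∧ 0 < B ∧ ∀ c : lp (fun _ : ι => ℂ) 2,
      Summable (fun k => c k • v k) ∧
        A * ‖c‖ ^ 2 ≤ ‖∑' k, c k • v k‖ ^ 2 ∧ ‖∑' k, c k • v k‖ ^ 2 ≤ B * ‖c‖ ^ 2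

/-- The orthogonal projection `P_{T,s}` of `L²(ℝ^d)` onto `V_{T,s,φ}`. -/
def proj {d : ℕ} (φ : L2 d) {T : ℝ} (hT : 0 < T) (s : ℝ) : L2 d →L[ℂ] L2 d :=
  (shiftSpace φ hT s).starProjection

/-- The periodization `∑_k |φ̂(η + 2 k π / s)|²`. -/
def periodization {d : ℕ} (φ : L2 d) (s : ℝ) (η : Rd d) : ℝ :=
  ∑' k : Fin d → ℤ, ‖fourierL2 φ (η + (2 * π / s) • latticePoint k)‖ ^ 2

/-- The error kernel `E_φ(s, η) = 1 - |φ̂(η)|² / ∑_k |φ̂(η + 2 k π / s)|²`. -/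
def errorKernel {d : ℕ} (φ : L2 d) (s : ℝ) (η : Rd d) : ℝ :=
  1 - ‖fourierL2 φ η‖ ^ 2 / periodization φ s η

/-- The cube `[-a, a]^d`. -/
def cube (d : ℕ) (a : ℝ) : Set (Rd d) :=
  {ξ | ∀ i, ξ i ∈ Set.Icc (-a) a}

/-- `f ∈ W_2^r(ℝ^d)`. The space is the same for all normalizations of the Fourier transform. -/
def MemW {d : ℕ} (r : ℝ) (f : L2 d) : Prop :=
  TemperedDistribution.MemSobolev r 2 (Lp.toTemperedDistribution f)

/-- The norm `‖f‖_{W_2^r} = (∫ (1 + ‖ξ‖²)^r |f̂(ξ)|² dξ)^(1/2)`, for `f ∈ W_2^r(ℝ^d)`. -/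
def normW {d : ℕ} (r : ℝ) (f : L2 d) : ℝ :=
  √(∫ ξ : Rd d, (1 + ‖ξ‖ ^ 2) ^ r * ‖fourierL2 f ξ‖ ^ 2)

end ShiftInvariant

end

/-!
On the Fourier side a generator `φ_{T,s}^k` is the character `ω ↦ exp(-2πi⟨T s k, ω⟩)` times the
generator with `k = 0` (`fourier_generator`). Put `a = 1 / (T s)`. The characters are periodic
with respect to `a ℤ^d`, so `ℝ^d` is cut into the translates of a cube of side `a`: `sheetMap`
identifies `ℝ^d`, as a measure space, with the product of the torus and the lattice, and
`fourierSheets` is the resulting isometry of `L²(ℝ^d)` into `L²` of that product. The image of the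
shift-invariant space is the closed span of the functions `e_k ψ`, where the `e_k` are the
characters of the torus and `ψ` is the image of the generator with `k = 0`.

Since trigonometric polynomials are dense in the continuous functions on the torus, an integrable
function on the torus is determined by its Fourier coefficients
(`ae_eq_zero_of_forall_integral_mul_eq_zero`), and a bound of a weighted quadratic form on
trigonometric polynomials gives a pointwise bound of the weight
(`ae_le_of_forall_integral_norm_sq_mul_le`). The second fact turns the lower Riesz bound into the
positivity of `[ψ, ψ](x) = ∑_j |ψ(x, j)|²`, which is the periodization of `|φ̂|²` up to a constant.
By the first fact, `h` is orthogonal to all `e_k ψ` if and only if the fibrewise bracket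
`[ψ, h](x) = ∑_j ψ(x, j) conj (h(x, j))` vanishes almost everywhere. Hence the projection of `g` is
`([g, ψ] / [ψ, ψ]) ψ`, and if `g` lives on a single sheet, its squared distance to the space is
`∫ |g|² (1 - |ψ|² / [ψ, ψ])` (`norm_sq_starProjection_sub_eq`).

The error formula follows by splitting `f` into its part with frequencies in the cube, which lives
on the central sheet and produces the integral of `|f̂|²` against the error kernel, and the rest.
The operator `P - 1` is a contraction, so the rest changes the norm by at most its own norm, which
the Sobolev weight bounds by `‖f‖ (T s / π)^r` (`norm_sub_lowPass_le`). In positive dimension the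
lattice sum in the claimed bound only enters through the fact that it is at least `1`.
-/

noncomputable section

namespace ShiftInvariant

/-! ### Testing integrable functions against continuous functions -/

section ContinuousTests

variable {X : Type*} [TopologicalSpace X] [CompactSpace X]
  [TopologicalSpace.PseudoMetrizableSpace X] [MeasurableSpace X] [BorelSpace X] {μ : Measure X} [IsFiniteMeasure μ]

open Filter Topology in
/-- The indicator of a closed set is a bounded limit of continuous functions, so the integrals of `w`
over closed sets are nonnegative; inner regularity excludes a set of positive measure where `w < 0`. -/
theorem ae_nonneg_of_forall_integral_continuousMap {w : X → ℝ} (hw : Integrable w μ)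
    (h : ∀ F : C(X, ℝ), (∀ x, 0 ≤ F x) → 0 ≤ ∫ x, F x * w x ∂μ) : 0 ≤ᵐ[μ] w := by
  have hclosed : ∀ K : Set X, IsClosed K → 0 ≤ ∫ x in K, w x ∂μ := by
    intro K hK
    have hlim : Tendsto (fun n : ℕ => ∫ x, ((hK.apprSeq n x : NNReal) : ℝ) * w x ∂μ) atTop
        (𝓝 (∫ x, K.indicator w x ∂μ)) := by
      refine tendsto_integral_of_dominated_convergence (fun x => ‖w x‖) (fun n => ?_) hw.norm
        (fun n => ?_) ?_
      · exact (((hK.apprSeq n).continuous.measurable.coe_nnreal_real).aestronglyMeasurable).mul hw.1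
      · refine ae_of_all _ fun x => ?_
        have h1 : ((hK.apprSeq n x : NNReal) : ℝ) ≤ 1 := by
          exact_mod_cast HasOuterApproxClosed.apprSeq_apply_le_one hK n x
        rw [norm_mul, Real.norm_of_nonneg (NNReal.coe_nonneg _)]
        exact mul_le_of_le_one_left (norm_nonneg _) h1
      · refine ae_of_all _ fun x => ?_
        have h1 := (tendsto_pi_nhds.1 (HasOuterApproxClosed.tendsto_apprSeq hK)) x
        have h2 := ((NNReal.continuous_coe.tendsto _).comp h1).mul_const (w x)
        have h3 : K.indicator w x =
            ((K.indicator (fun _ => (1 : NNReal)) x : NNReal) : ℝ) * w x := by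
          by_cases hx : x ∈ K <;> simp [hx]
        rw [h3]
        exact h2
    rw [integral_indicator hK.measurableSet] at hlim
    refine ge_of_tendsto' hlim fun n => ?_
    exact h ⟨fun x => ((hK.apprSeq n x : NNReal) : ℝ),
      NNReal.continuous_coe.comp (hK.apprSeq n).continuous⟩ fun x => NNReal.coe_nonneg _
  set w' := hw.1.mk w with hw'
  have hww' : w =ᵐ[μ] w' := hw.1.ae_eq_mk
  have hmeas : MeasurableSet {x | w' x < 0} :=
    measurableSet_lt hw.1.stronglyMeasurable_mk.measurable measurable_const
  have hzero : μ {x | w' x < 0} = 0 := by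
    by_contra hne
    obtain ⟨K, hKsub, hK, hKpos⟩ := hmeas.exists_lt_isClosed_of_ne_top (measure_ne_top μ _)
      (pos_iff_ne_zero.2 hne)
    have hint : IntegrableOn (fun x => -w' x) K μ := (hw.congr hww').neg.integrableOn
    have hpos : 0 < ∫ x in K, -w' x ∂μ := by
      rw [setIntegral_pos_iff_support_of_nonneg_ae _ hint]
      · refine hKpos.trans_le (measure_mono fun x hx => ⟨?_, hx⟩)
        have := hKsub hx
        simp only [Set.mem_ofPred_eq] at this
        simp [this.ne]
      · filter_upwards [ae_restrict_mem hK.measurableSet] with x hx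
        have := hKsub hx
        simp only [Set.mem_ofPred_eq] at this
        simp [this.le]
    have h1 := hclosed K hK
    rw [integral_congr_ae (ae_restrict_of_ae hww')] at h1
    rw [integral_neg] at hpos
    linarith
  have hae : ∀ᵐ x ∂μ, ¬ w' x < 0 := by
    rw [ae_iff]; simpa using hzero
  filter_upwards [hae, hww'] with x h1 h2
  rw [h2]; simpa using h1

omit [TopologicalSpace.PseudoMetrizableSpace X] [IsFiniteMeasure μ] in
theorem continuous_integral_mul_continuousMap {w : X → ℂ} (hw : Integrable w μ) :
    Continuous fun F : C(X, ℂ) => ∫ x, F x * w x ∂μ := by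
  have hint : ∀ F : C(X, ℂ), Integrable (fun x => F x * w x) μ := fun F =>
    hw.bdd_mul F.continuous.aestronglyMeasurable (ae_of_all _ F.norm_coe_le_norm)
  let L : C(X, ℂ) →+ ℂ :=
    { toFun := fun F => ∫ x, F x * w x ∂μ
      map_zero' := by simp
      map_add' := fun F G => by
        simp only [ContinuousMap.add_apply, add_mul]
        exact integral_add (hint F) (hint G) }
  refine AddMonoidHomClass.continuous_of_bound L (∫ x, ‖w x‖ ∂μ) fun F => ?_
  calc ‖∫ x, F x * w x ∂μ‖ ≤ ∫ x, ‖F‖ * ‖w x‖ ∂μ := by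
        refine norm_integral_le_of_norm_le (hw.norm.const_mul _) (ae_of_all _ fun x => ?_)
        rw [norm_mul]
        gcongr
        exact F.norm_coe_le_norm x
    _ = (∫ x, ‖w x‖ ∂μ) * ‖F‖ := by rw [integral_const_mul, mul_comm]

variable {K : Type*} {e : K → C(X, ℂ)}

/-- An integrable function on a compact space vanishes as soon as it is orthogonal to a family of
continuous functions with dense span: this is the uniqueness of Fourier coefficients in `L¹`. -/
theorem ae_eq_zero_of_forall_integral_mul_eq_zero
    (hdense : (Submodule.span ℂ (Set.range e)).topologicalClosure = ⊤)
    {w : X → ℂ} (hw : Integrable w μ) (h : ∀ k, ∫ x, e k x * w x ∂μ = 0) : w =ᵐ[μ] 0 := by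
  have hint : ∀ F : C(X, ℂ), Integrable (fun x => F x * w x) μ := fun F =>
    hw.bdd_mul F.continuous.aestronglyMeasurable (ae_of_all _ F.norm_coe_le_norm)
  have hspan : ∀ F ∈ Submodule.span ℂ (Set.range e), ∫ x, F x * w x ∂μ = 0 := by
    intro F hF
    induction hF using Submodule.span_induction with
    | mem F hF => obtain ⟨k, rfl⟩ := hF; exact h k
    | zero => simp
    | add F G _ _ hF hG =>
      simp only [ContinuousMap.add_apply, add_mul]
      rw [integral_add (hint F) (hint G), hF, hG, add_zero]
    | smul c F _ hF =>
      simp only [ContinuousMap.smul_apply, smul_eq_mul, mul_assoc]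
      rw [integral_const_mul, hF, mul_zero]
  have hall : ∀ F : C(X, ℂ), ∫ x, F x * w x ∂μ = 0 := by
    intro F
    have hF : F ∈ closure (Submodule.span ℂ (Set.range e) : Set C(X, ℂ)) := by
      rw [← Submodule.topologicalClosure_coe, hdense]; trivial
    exact closure_minimal hspan
      (isClosed_eq (continuous_integral_mul_continuousMap hw) continuous_const) hF
  have hreal : ∀ F : C(X, ℝ), ∫ x, F x * (w x).re ∂μ = 0 ∧ ∫ x, F x * (w x).im ∂μ = 0 := by
    intro F
    have h1 := hall ⟨fun x => (F x : ℂ), Complex.continuous_ofReal.comp F.continuous⟩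
    have h2 := hint ⟨fun x => (F x : ℂ), Complex.continuous_ofReal.comp F.continuous⟩
    simp only [ContinuousMap.coe_mk] at h1 h2
    have hre := integral_re h2
    have him := integral_im h2
    rw [h1] at hre him
    simpa using And.intro hre him
  have hre := ae_nonneg_of_forall_integral_continuousMap hw.re
    fun F _ => by simpa using (hreal F).1.ge
  have hre' := ae_nonneg_of_forall_integral_continuousMap hw.re.neg
    fun F _ => by simpa [integral_neg] using (hreal F).1.le
  have him := ae_nonneg_of_forall_integral_continuousMap hw.im
    fun F _ => by simpa using (hreal F).2.ge
  have him' := ae_nonneg_of_forall_integral_continuousMap hw.im.neg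
    fun F _ => by simpa [integral_neg] using (hreal F).2.le
  filter_upwards [hre, hre', him, him'] with x h1 h2 h3 h4
  simp at h1 h2 h3 h4
  exact Complex.ext (le_antisymm h2 h1) (le_antisymm h4 h3)

/-- A lower bound of the quadratic form `p ↦ ∫ |p|² S` on a dense family of continuous functions is
a pointwise lower bound of the weight `S`. -/
theorem ae_le_of_forall_integral_norm_sq_mul_le
    (hdense : (Submodule.span ℂ (Set.range e)).topologicalClosure = ⊤)
    {S : X → ℝ} (hS : Integrable S μ) {A : ℝ}
    (h : ∀ p ∈ Submodule.span ℂ (Set.range e),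
      A * ∫ x, ‖p x‖ ^ 2 ∂μ ≤ ∫ x, ‖p x‖ ^ 2 * S x ∂μ) : ∀ᵐ x ∂μ, A ≤ S x := by
  have hw : Integrable (fun x => S x - A) μ := hS.sub (integrable_const A)
  have hwC : Integrable (fun x => ((S x - A : ℝ) : ℂ)) μ := hw.ofReal
  have hq : ∀ F : C(X, ℂ), (∫ x, (F * star F) x * ((S x - A : ℝ) : ℂ) ∂μ) =
      ((∫ x, ‖F x‖ ^ 2 * (S x - A) ∂μ : ℝ) : ℂ) := by
    intro F
    rw [← integral_complex_ofReal]
    congr with x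
    simp [Complex.mul_conj, Complex.normSq_eq_norm_sq]
  have hcont : Continuous fun F : C(X, ℂ) => ∫ x, ‖F x‖ ^ 2 * (S x - A) ∂μ := by
    have h1 : Continuous fun F : C(X, ℂ) =>
        (∫ x, (F * star F) x * ((S x - A : ℝ) : ℂ) ∂μ).re :=
      Complex.continuous_re.comp ((continuous_integral_mul_continuousMap hwC).comp
        (continuous_id.mul continuous_star))
    simpa only [hq, Complex.ofReal_re] using h1
  have hall : ∀ F : C(X, ℂ), 0 ≤ ∫ x, ‖F x‖ ^ 2 * (S x - A) ∂μ := by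
    intro F
    have hF : F ∈ closure (Submodule.span ℂ (Set.range e) : Set C(X, ℂ)) := by
      rw [← Submodule.topologicalClosure_coe, hdense]; trivial
    refine closure_minimal (fun p hp => ?_) (isClosed_le continuous_const hcont) hF
    have hb : Continuous fun x => ‖p x‖ ^ 2 := by fun_prop
    have hbd : ∀ x, ‖‖p x‖ ^ 2‖ ≤ ‖p‖ ^ 2 := fun x => by
      rw [norm_pow, norm_norm]; gcongr; exact p.norm_coe_le_norm x
    have i1 : Integrable (fun x => ‖p x‖ ^ 2 * S x) μ :=
      hS.bdd_mul hb.aestronglyMeasurable (ae_of_all _ hbd)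
    have i2 : Integrable (fun x => ‖p x‖ ^ 2 * A) μ :=
      (integrable_const A).bdd_mul hb.aestronglyMeasurable (ae_of_all _ hbd)
    have := h p hp
    simp only [Set.mem_ofPred_eq, mul_sub]
    rw [integral_sub i1 i2, integral_mul_const]
    linarith
  have := ae_nonneg_of_forall_integral_continuousMap hw fun F hF => by
    have h1 := hall ⟨fun x => (√(F x) : ℂ),
      Complex.continuous_ofReal.comp (Real.continuous_sqrt.comp F.continuous)⟩
    simpa [Real.sq_sqrt, hF] using h1
  filter_upwards [this] with x hx
  simpa using hx

end ContinuousTests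

/-! ### Projection onto a space of fibrewise multiples of a generator -/

section Fibre

variable {X : Type*} [MeasurableSpace X] {μ : Measure X}
variable {J : Type*} [MeasurableSpace J] [MeasurableSingletonClass J] [Countable J]

theorem integral_count_eq_tsum {E : Type*} [NormedAddCommGroup E] [NormedSpace ℝ E]
    [CompleteSpace E] {f : J → E} (hf : Summable fun j => ‖f j‖) :
    ∫ j, f j ∂Measure.count = ∑' j, f j := by
  rw [integral_countable (integrable_count_iff.2 hf)]
  simp [Measure.real]

variable [SFinite μ]

theorem integrable_norm_sq_coeFn {Y : Type*} [MeasurableSpace Y] {ν : Measure Y} (f : Lp ℂ 2 ν) :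
    Integrable (fun y => ‖f y‖ ^ 2) ν :=
  (memLp_two_iff_integrable_sq_norm (Lp.aestronglyMeasurable f)).1 (Lp.memLp f)

theorem norm_sq_eq_integral_coeFn {Y : Type*} [MeasurableSpace Y] {ν : Measure Y} (f : Lp ℂ 2 ν) :
    ‖f‖ ^ 2 = ∫ y, ‖f y‖ ^ 2 ∂ν := by
  have h := L2.inner_def (𝕜 := ℂ) f f
  rw [inner_self_eq_norm_sq_to_K] at h
  have h2 : (∫ y, inner ℂ (f y) (f y) ∂ν) = ((∫ y, ‖f y‖ ^ 2 ∂ν : ℝ) : ℂ) := by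
    rw [← integral_complex_ofReal]
    congr with y
    rw [inner_self_eq_norm_sq_to_K]; norm_cast
  rw [h2] at h
  exact Complex.ofReal_injective (by rw [← h]; simp)

theorem ae_summable_norm_sq_fibre (ψ : Lp ℂ 2 (μ.prod (Measure.count : Measure J))) :
    ∀ᵐ x ∂μ, Summable fun j => ‖ψ (x, j)‖ ^ 2 := by
  filter_upwards [(integrable_norm_sq_coeFn ψ).prod_right_ae] with x hx
  simpa using integrable_count_iff.1 hx

omit [MeasurableSingletonClass J] [SFinite μ] in
theorem measurable_tsum_norm_sq_fibre (ψ : Lp ℂ 2 (μ.prod (Measure.count : Measure J))) :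
    Measurable fun x => ∑' j, ‖ψ (x, j)‖ ^ 2 :=
  Measurable.tsum fun _ =>
    (((Lp.stronglyMeasurable ψ).measurable.comp measurable_prodMk_right).norm.pow_const 2)

theorem integral_prod_count_norm_sq (ψ : Lp ℂ 2 (μ.prod (Measure.count : Measure J)))
    {m : X → ℝ} (hint : Integrable (fun y => m y.1 * ‖ψ y‖ ^ 2)
      (μ.prod (Measure.count : Measure J))) :
    ∫ y, m y.1 * ‖ψ y‖ ^ 2 ∂(μ.prod (Measure.count : Measure J)) =
      ∫ x, m x * ∑' j, ‖ψ (x, j)‖ ^ 2 ∂μ := by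
  rw [integral_prod _ hint]
  refine integral_congr_ae ?_
  filter_upwards [ae_summable_norm_sq_fibre ψ] with x hx
  rw [← tsum_mul_left, integral_count_eq_tsum]
  simpa [abs_mul] using hx.mul_left |m x|

theorem integrable_tsum_norm_sq_fibre (ψ : Lp ℂ 2 (μ.prod (Measure.count : Measure J))) :
    Integrable (fun x => ∑' j, ‖ψ (x, j)‖ ^ 2) μ := by
  refine ((integrable_norm_sq_coeFn ψ).integral_prod_left).congr ?_
  filter_upwards [ae_summable_norm_sq_fibre ψ] with x hx
  rw [integral_count_eq_tsum]
  simpa using hx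

end Fibre

section FibreProjection

open scoped ComplexConjugate

variable {X : Type*} [MeasurableSpace X] {μ : Measure X} [SFinite μ]
variable {J : Type*} [MeasurableSpace J] [MeasurableSingletonClass J] [Countable J]

theorem ae_summable_mul_conj_fibre (ψ h : Lp ℂ 2 (μ.prod (Measure.count : Measure J))) :
    ∀ᵐ x ∂μ, Summable fun j => ‖ψ (x, j) * conj (h (x, j))‖ := by
  filter_upwards [(L2.integrable_inner (𝕜 := ℂ) h ψ).prod_right_ae] with x hx
  simpa using integrable_count_iff.1 hx

/-- The fibrewise bracket `[ψ, h](x) = ∑_j ψ(x, j) conj (h(x, j))` of two square integrable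
functions. -/
def bracket (ψ h : Lp ℂ 2 (μ.prod (Measure.count : Measure J))) (x : X) : ℂ :=
  ∑' j, ψ (x, j) * conj (h (x, j))

theorem integrable_bracket (ψ h : Lp ℂ 2 (μ.prod (Measure.count : Measure J))) :
    Integrable (bracket ψ h) μ := by
  refine ((L2.integrable_inner (𝕜 := ℂ) h ψ).integral_prod_left).congr ?_
  filter_upwards [ae_summable_mul_conj_fibre ψ h] with x hx
  simp only [RCLike.inner_apply]
  exact integral_count_eq_tsum hx

/-- Integrating over the fibres first turns the inner product with a periodic multiple of `ψ` into
an integral over the base. -/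
theorem inner_eq_integral_mul_bracket {ψ h p : Lp ℂ 2 (μ.prod (Measure.count : Measure J))}
    {m : X → ℂ} (hp : p =ᵐ[μ.prod Measure.count] fun y => m y.1 * ψ y) :
    inner ℂ h p = ∫ x, m x * bracket ψ h x ∂μ := by
  rw [L2.inner_def, integral_prod _ (L2.integrable_inner (𝕜 := ℂ) h p)]
  refine integral_congr_ae ?_
  filter_upwards [ae_summable_mul_conj_fibre ψ h, Measure.ae_ae_of_ae_prod hp] with x hx hx'
  rw [Measure.ae_count_iff] at hx'
  rw [bracket, ← tsum_mul_left, ← integral_count_eq_tsum]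
  · congr with j
    rw [hx', RCLike.inner_apply]; ring
  · simpa only [norm_mul] using (hx.mul_left ‖m x‖)

/-- The orthogonal projection onto the closed span of the functions `e_k ψ`, where `(e_k)` is total
in `C(X)`, of a function `g` supported on the single sheet `j₀`: it is `m ψ` with
`m = [g, ψ] / [ψ, ψ]`, and the distance is computed fibre by fibre. -/
theorem norm_sq_starProjection_sub_eq [TopologicalSpace X] [CompactSpace X]
    [TopologicalSpace.PseudoMetrizableSpace X] [BorelSpace X] [IsFiniteMeasure μ]
    {K : Type*} {e : K → C(X, ℂ)}
    (hdense : (Submodule.span ℂ (Set.range e)).topologicalClosure = ⊤)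
    {ψ g : Lp ℂ 2 (μ.prod (Measure.count : Measure J))}
    {v : K → Lp ℂ 2 (μ.prod (Measure.count : Measure J))}
    (hv : ∀ k, v k =ᵐ[μ.prod Measure.count] fun y => e k y.1 * ψ y) (j₀ : J)
    (hg : ∀ᵐ x ∂μ, ∀ j ≠ j₀, g (x, j) = 0)
    (hS : ∀ᵐ x ∂μ, 0 < ∑' j, ‖ψ (x, j)‖ ^ 2) :
    ‖(Submodule.span ℂ (Set.range v)).topologicalClosure.starProjection g - g‖ ^ 2 =
      ∫ x, ‖g (x, j₀)‖ ^ 2 * (1 - ‖ψ (x, j₀)‖ ^ 2 / ∑' j, ‖ψ (x, j)‖ ^ 2) ∂μ := by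
  set S : X → ℝ := fun x => ∑' j, ‖ψ (x, j)‖ ^ 2 with hSdef
  set m : X → ℂ := fun x => g (x, j₀) * conj (ψ (x, j₀)) / S x with hm
  have hSmeas : Measurable S := measurable_tsum_norm_sq_fibre ψ
  have hslice : ∀ f : Lp ℂ 2 (μ.prod (Measure.count : Measure J)),
      Measurable fun x => f (x, j₀) := fun f =>
    (Lp.stronglyMeasurable f).measurable.comp measurable_prodMk_right
  have hmmeas : Measurable m :=
    ((hslice g).mul (Complex.continuous_conj.measurable.comp (hslice ψ))).div
      (Complex.measurable_ofReal.comp hSmeas)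
  have hsumψ := ae_summable_norm_sq_fibre ψ
  have hψ0 : ∀ᵐ x ∂μ, ‖ψ (x, j₀)‖ ^ 2 ≤ S x := by
    filter_upwards [hsumψ] with x hx
    exact hx.le_tsum j₀ fun _ _ => by positivity
  have hgS : ∀ᵐ x ∂μ, ∑' j, ‖g (x, j)‖ ^ 2 = ‖g (x, j₀)‖ ^ 2 := by
    filter_upwards [hg] with x hx
    exact tsum_eq_single j₀ fun j hj => by simp [hx j hj]
  have hg0int : Integrable (fun x => ‖g (x, j₀)‖ ^ 2) μ :=
    (integrable_tsum_norm_sq_fibre g).congr hgS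
  -- `‖m‖² S = ‖g‖² ‖ψ‖² / S` on the sheet `j₀`, which is at most `‖g‖²`
  have hmS : ∀ᵐ x ∂μ, ‖m x‖ ^ 2 * S x = ‖g (x, j₀)‖ ^ 2 * (‖ψ (x, j₀)‖ ^ 2 / S x) := by
    filter_upwards [hS] with x hx
    have hx' : 0 < S x := hx
    simp only [hm, norm_div, norm_mul, RCLike.norm_conj, Complex.norm_real,
      Real.norm_of_nonneg hx'.le]
    field_simp
  have hratio : ∀ᵐ x ∂μ, 0 ≤ ‖ψ (x, j₀)‖ ^ 2 / S x ∧ ‖ψ (x, j₀)‖ ^ 2 / S x ≤ 1 := by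
    filter_upwards [hS, hψ0] with x hx hx'
    exact ⟨div_nonneg (by positivity) hx.le, div_le_one_of_le₀ hx' hx.le⟩
  have hratiomeas : Measurable fun x => ‖ψ (x, j₀)‖ ^ 2 / S x :=
    ((hslice ψ).norm.pow_const 2).div hSmeas
  have hint1 : Integrable (fun x => ‖g (x, j₀)‖ ^ 2 * (‖ψ (x, j₀)‖ ^ 2 / S x)) μ := by
    refine hg0int.mul_bdd (c := 1) hratiomeas.aestronglyMeasurable ?_
    filter_upwards [hratio] with x hx
    rw [Real.norm_of_nonneg hx.1]; exact hx.2
  have hpmeas : AEStronglyMeasurable (fun y : X × J => m y.1 * ψ y)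
      (μ.prod (Measure.count : Measure J)) :=
    (hmmeas.comp measurable_fst).aestronglyMeasurable.mul (Lp.aestronglyMeasurable ψ)
  have hpint : Integrable (fun y : X × J => ‖m y.1‖ ^ 2 * ‖ψ y‖ ^ 2)
      (μ.prod (Measure.count : Measure J)) := by
    have hmeas2 : AEStronglyMeasurable (fun y : X × J => ‖m y.1‖ ^ 2 * ‖ψ y‖ ^ 2)
        (μ.prod (Measure.count : Measure J)) :=
      (hpmeas.norm.pow 2).congr (ae_of_all _ fun y => by simp [mul_pow])
    rw [integrable_prod_iff hmeas2]
    constructor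
    · filter_upwards [hsumψ] with x hx
      rw [integrable_count_iff]
      simpa using hx.mul_left (‖m x‖ ^ 2)
    · refine hint1.congr ?_
      filter_upwards [hsumψ, hmS] with x hx hx'
      rw [← hx', hSdef, ← tsum_mul_left, integral_count_eq_tsum]
      · simp
      · simpa using hx.mul_left (‖m x‖ ^ 2)
  have hpLp : MemLp (fun y : X × J => m y.1 * ψ y) 2 (μ.prod (Measure.count : Measure J)) := by
    rw [memLp_two_iff_integrable_sq_norm hpmeas]
    simpa only [norm_mul, mul_pow] using hpint
  set p : Lp ℂ 2 (μ.prod (Measure.count : Measure J)) := hpLp.toLp _ with hpdef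
  have hp : p =ᵐ[μ.prod Measure.count] fun y => m y.1 * ψ y := hpLp.coeFn_toLp
  set W := Submodule.span ℂ (Set.range v) with hW
  -- `p` is orthogonal to everything orthogonal to the generators
  have hpmem : p ∈ W.topologicalClosure := by
    rw [← Submodule.orthogonal_orthogonal_eq_closure, Submodule.mem_orthogonal]
    intro h hh
    have hzero : bracket ψ h =ᵐ[μ] 0 := by
      refine ae_eq_zero_of_forall_integral_mul_eq_zero hdense (integrable_bracket ψ h) fun k => ?_
      rw [← inner_eq_integral_mul_bracket (hv k)]
      exact (Submodule.mem_orthogonal' _ _).1 hh _ (Submodule.subset_span ⟨k, rfl⟩)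
    rw [inner_eq_integral_mul_bracket hp, ← integral_zero X ℂ (μ := μ)]
    refine integral_congr_ae ?_
    filter_upwards [hzero] with x hx
    simp [hx]
  have hgp : g - p ∈ W.topologicalClosureᗮ := by
    rw [Submodule.orthogonal_closure, Submodule.mem_orthogonal']
    have hzero : bracket ψ (g - p) =ᵐ[μ] 0 := by
      filter_upwards [Measure.ae_ae_of_ae_prod hp, Measure.ae_ae_of_ae_prod (Lp.coeFn_sub g p),
        hg, hS, hsumψ] with x h1 h2 h3 h4 h5
      rw [Measure.ae_count_iff] at h1 h2
      have hterm : ∀ j, ψ (x, j) * conj ((g - p : Lp ℂ 2 _) (x, j)) =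
          ψ (x, j) * conj (g (x, j)) - conj (m x) * ((‖ψ (x, j)‖ ^ 2 : ℝ) : ℂ) := by
        intro j
        rw [h2, Pi.sub_apply, h1, map_sub, map_mul, Complex.ofReal_pow, ← Complex.mul_conj']
        ring
      have hg1 : ∀ j ≠ j₀, ψ (x, j) * conj (g (x, j)) = 0 := fun j hj => by simp [h3 j hj]
      have hsum1 : Summable fun j => ψ (x, j) * conj (g (x, j)) :=
        (hasSum_single j₀ hg1).summable
      have hsum2 : Summable fun j => conj (m x) * ((‖ψ (x, j)‖ ^ 2 : ℝ) : ℂ) :=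
        (Complex.summable_ofReal.2 h5).mul_left _
      have hSx : (S x : ℂ) ≠ 0 := Complex.ofReal_ne_zero.2 h4.ne'
      simp only [bracket, hterm]
      rw [hsum1.tsum_sub hsum2, tsum_eq_single j₀ hg1, tsum_mul_left, ← Complex.ofReal_tsum]
      change _ - conj (m x) * (S x : ℂ) = 0
      simp only [hm, map_div₀, map_mul, Complex.conj_conj, Complex.conj_ofReal]
      field_simp
      ring
    intro u hu
    induction hu using Submodule.span_induction with
    | mem u hu =>
      obtain ⟨k, rfl⟩ := hu
      rw [inner_eq_integral_mul_bracket (hv k), ← integral_zero X ℂ (μ := μ)]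
      refine integral_congr_ae ?_
      filter_upwards [hzero] with x hx
      simp [hx]
    | zero => simp
    | add a b _ _ ha hb => rw [inner_add_right, ha, hb, add_zero]
    | smul c a _ ha => rw [inner_smul_right, ha, mul_zero]
  rw [Submodule.eq_starProjection_of_mem_orthogonal hpmem hgp]
  have hpyth : ‖g‖ ^ 2 = ‖p‖ ^ 2 + ‖p - g‖ ^ 2 := by
    have h0 : inner ℂ p (g - p) = 0 := (Submodule.mem_orthogonal _ _).1 hgp p hpmem
    have := norm_add_sq_eq_norm_sq_add_norm_sq_of_inner_eq_zero p (g - p) h0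
    rw [add_sub_cancel] at this
    rw [norm_sub_rev p g]
    nlinarith
  have hgn : ‖g‖ ^ 2 = ∫ x, ‖g (x, j₀)‖ ^ 2 ∂μ := by
    have := integral_prod_count_norm_sq g (m := fun _ => 1)
      (by simpa using integrable_norm_sq_coeFn g)
    simp only [one_mul] at this
    rw [norm_sq_eq_integral_coeFn, this]
    exact integral_congr_ae hgS
  have hpn : ‖p‖ ^ 2 = ∫ x, ‖g (x, j₀)‖ ^ 2 * (‖ψ (x, j₀)‖ ^ 2 / S x) ∂μ := by
    rw [norm_sq_eq_integral_coeFn, ← integral_congr_ae hmS,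
      ← integral_prod_count_norm_sq ψ (m := fun x => ‖m x‖ ^ 2) hpint]
    refine integral_congr_ae ?_
    filter_upwards [hp] with y hy
    rw [hy, norm_mul, mul_pow]
  have hfin : ‖p - g‖ ^ 2 = ‖g‖ ^ 2 - ‖p‖ ^ 2 := by linarith
  rw [hfin, hgn, hpn, ← integral_sub hg0int hint1]
  congr with x
  ring

/-- If the functions `e_k ψ` satisfy the lower Riesz bound, relative to the norms of the
combinations of the `e_k`, then the fibre norms of `ψ` are bounded below. -/
theorem ae_le_tsum_norm_sq_fibre [TopologicalSpace X] [CompactSpace X]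
    [TopologicalSpace.PseudoMetrizableSpace X] [BorelSpace X] [IsFiniteMeasure μ]
    {K : Type*} {e : K → C(X, ℂ)}
    (hdense : (Submodule.span ℂ (Set.range e)).topologicalClosure = ⊤)
    {ψ : Lp ℂ 2 (μ.prod (Measure.count : Measure J))}
    {v : K → Lp ℂ 2 (μ.prod (Measure.count : Measure J))}
    (hv : ∀ k, v k =ᵐ[μ.prod Measure.count] fun y => e k y.1 * ψ y) {A : ℝ}
    (hA : ∀ c : K →₀ ℂ, A * ∫ x, ‖(Finsupp.linearCombination ℂ e c) x‖ ^ 2 ∂μ ≤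
      ‖Finsupp.linearCombination ℂ v c‖ ^ 2) :
    ∀ᵐ x ∂μ, A ≤ ∑' j, ‖ψ (x, j)‖ ^ 2 := by
  refine ae_le_of_forall_integral_norm_sq_mul_le hdense (integrable_tsum_norm_sq_fibre ψ) ?_
  intro q hq
  obtain ⟨c, rfl⟩ := Finsupp.mem_span_range_iff_exists_finsupp.1 hq
  have hcomb : Finsupp.linearCombination ℂ v c =ᵐ[μ.prod Measure.count]
      fun y => (Finsupp.linearCombination ℂ e c) y.1 * ψ y := by
    induction c using Finsupp.induction_linear with
    | zero =>
      simp only [map_zero, ContinuousMap.zero_apply, zero_mul]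
      exact Lp.coeFn_zero _ _ _
    | add a b ha hb =>
      simp only [map_add]
      filter_upwards [ha (Submodule.sum_mem _ fun k _ => Submodule.smul_mem _ _
        (Submodule.subset_span ⟨k, rfl⟩)), hb (Submodule.sum_mem _ fun k _ =>
        Submodule.smul_mem _ _ (Submodule.subset_span ⟨k, rfl⟩)), Lp.coeFn_add
        (Finsupp.linearCombination ℂ v a) (Finsupp.linearCombination ℂ v b)] with y h1 h2 h3
      rw [h3, Pi.add_apply, h1, h2, ContinuousMap.add_apply, add_mul]
    | single k c =>
      simp only [Finsupp.linearCombination_single]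
      filter_upwards [hv k, Lp.coeFn_smul c (v k)] with y h1 h2
      rw [h2, Pi.smul_apply, h1, ContinuousMap.smul_apply, smul_eq_mul, smul_eq_mul, mul_assoc]
  refine (hA c).trans (le_of_eq ?_)
  have hnorm : (fun y => ‖(Finsupp.linearCombination ℂ v c) y‖ ^ 2) =ᵐ[μ.prod Measure.count]
      fun y => ‖(Finsupp.linearCombination ℂ e c) y.1‖ ^ 2 * ‖ψ y‖ ^ 2 := by
    filter_upwards [hcomb] with y hy
    rw [hy, norm_mul, mul_pow]
  rw [norm_sq_eq_integral_coeFn, integral_congr_ae hnorm]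
  exact integral_prod_count_norm_sq ψ
    (m := fun x => ‖(Finsupp.linearCombination ℂ e c) x‖ ^ 2)
    ((integrable_norm_sq_coeFn _).congr hnorm)

end FibreProjection

/-! ### The torus as a fundamental domain -/

variable {d : ℕ}

/-- The torus `(ℝ / ℤ)^d`. -/
abbrev Torus (d : ℕ) : Type := UnitAddTorus (Fin d)

/-- The Haar probability measure of the torus, as a product measure. -/
def torusMeasure (d : ℕ) : Measure (Torus d) := Measure.pi fun _ => AddCircle.haarAddCircle

instance : IsProbabilityMeasure (torusMeasure d) := by
  unfold torusMeasure; infer_instance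

/-- The representative in the half-open cube `(-1/2, 1/2]^d` of a point of the torus. -/
def rep (x : Torus d) : Rd d :=
  WithLp.toLp 2 fun i => (AddCircle.equivIoc 1 (-1 / 2 : ℝ) (x i)).1

/-- The half-open cube `(-1/2, 1/2]^d`, with the right end point written as `-1/2 + 1`. -/
def unitBox (d : ℕ) : Set (Rd d) := {y | ∀ i, y i ∈ Set.Ioc (-1 / 2 : ℝ) (-1 / 2 + 1)}

theorem rep_mem_unitBox (x : Torus d) : rep x ∈ unitBox d :=
  fun i => (AddCircle.equivIoc 1 (-1 / 2 : ℝ) (x i)).2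

theorem measurable_coord (i : Fin d) : Measurable fun y : Rd d => y i := by fun_prop

theorem measurableSet_unitBox : MeasurableSet (unitBox d) := by
  rw [unitBox, Set.ofPred_forall]
  exact MeasurableSet.iInter fun i => measurable_coord i measurableSet_Ioc

theorem coe_rep (x : Torus d) (i : Fin d) : ((rep x i : ℝ) : UnitAddCircle) = x i :=
  AddCircle.coe_equivIoc

theorem measurePreserving_rep :
    MeasurePreserving (rep (d := d)) (torusMeasure d) (volume.restrict (unitBox d)) := by
  have h1 := UnitAddTorus.measurePreserving_equivPiIoc (d := Fin d) fun _ => (-1 / 2 : ℝ)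
  have hmeas : MeasurableSet {x : Fin d → ℝ | ∀ i, x i ∈ Set.Ioc (-1 / 2 : ℝ) (-1 / 2 + 1)} :=
    MeasurableSet.univ_pi' fun i => measurableSet_Ioc
  have h2 := measurePreserving_subtype_coe (μa := (volume : Measure (Fin d → ℝ))) hmeas
  have h3 := (PiLp.volume_preserving_toLp (Fin d)).restrict_preimage
    (measurableSet_unitBox (d := d))
  exact h3.comp (h2.comp h1)

/-- The integer part of a point, i.e. the label of the translate of the unit box it lies in. -/
def boxIndex (y : Rd d) : Fin d → ℤ := fun i => ⌈y i - 1 / 2⌉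

/-- The translates of the unit box by the lattice partition the space. -/
theorem boxIndex_eq_iff (y : Rd d) (j : Fin d → ℤ) :
    boxIndex y = j ↔ y - latticePoint j ∈ unitBox d := by
  rw [funext_iff]
  refine forall_congr' fun i => ?_
  rw [boxIndex, Int.ceil_eq_iff]
  simp only [latticePoint, PiLp.sub_apply, Set.mem_Ioc]
  constructor <;> rintro ⟨h1, h2⟩ <;> constructor <;> linarith

/-- The parametrization `(x, j) ↦ a (rep x + j)` of `ℝ^d` by the torus and the lattice. -/
def sheetMap (a : ℝ) (y : Torus d × (Fin d → ℤ)) : Rd d := a • (rep y.1 + latticePoint y.2)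

theorem measurePreserving_rep_add_latticePoint :
    MeasurePreserving (fun y : Torus d × (Fin d → ℤ) => rep y.1 + latticePoint y.2)
      ((torusMeasure d).prod Measure.count) volume := by
  have hmeas : Measurable (fun y : Torus d × (Fin d → ℤ) => rep y.1 + latticePoint y.2) :=
    measurable_from_prod_countable_left fun j =>
      measurePreserving_rep.measurable.add_const (latticePoint j)
  refine ⟨hmeas, ?_⟩
  ext B hB
  have hpiece : ∀ j : Fin d → ℤ, MeasurableSet {y : Rd d | y - latticePoint j ∈ unitBox d} :=
    fun j => measurableSet_unitBox.preimage (measurable_id.sub_const _)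
  rw [Measure.map_apply hmeas hB, Measure.prod_apply_symm (hmeas hB), lintegral_count]
  have hterm : ∀ j : Fin d → ℤ, torusMeasure d
      ((fun x => (x, j)) ⁻¹' ((fun y : Torus d × (Fin d → ℤ) => rep y.1 + latticePoint y.2) ⁻¹' B))
      = volume (B ∩ {y : Rd d | y - latticePoint j ∈ unitBox d}) := by
    intro j
    have hBj : MeasurableSet {y : Rd d | y + latticePoint j ∈ B} :=
      hB.preimage (measurable_id.add_const _)
    calc _ = torusMeasure d (rep ⁻¹' {y : Rd d | y + latticePoint j ∈ B}) := rfl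
      _ = volume ({y : Rd d | y + latticePoint j ∈ B} ∩ unitBox d) := by
        rw [measurePreserving_rep.measure_preimage hBj.nullMeasurableSet,
          Measure.restrict_apply hBj]
      _ = volume ((fun y : Rd d => y + latticePoint j) ⁻¹'
            (B ∩ {y : Rd d | y - latticePoint j ∈ unitBox d})) := by
        congr 1
        ext y
        simp
      _ = _ := measure_preimage_add_right _ _ _
  simp only [hterm]
  rw [← measure_iUnion]
  · congr 1
    ext y
    simp only [Set.mem_iUnion, Set.mem_inter_iff]
    exact ⟨fun ⟨_, h⟩ => h.1, fun h => ⟨boxIndex y, h, (boxIndex_eq_iff y _).1 rfl⟩⟩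
  · intro i j hij
    refine Set.disjoint_left.2 fun y h1 h2 => hij ?_
    rw [← (boxIndex_eq_iff y i).2 h1.2, (boxIndex_eq_iff y j).2 h2.2]
  · exact fun j => hB.inter (hpiece j)

theorem measurePreserving_const_smul {a : ℝ} (ha : 0 < a) :
    MeasurePreserving (fun y : Rd d => a • y) (ENNReal.ofReal (a ^ d) • volume) volume := by
  refine ⟨measurable_const_smul a, ?_⟩
  rw [Measure.map_smul, Measure.map_addHaar_smul volume ha.ne', smul_smul,
    finrank_euclideanSpace_fin, abs_of_pos (by positivity), ← ENNReal.ofReal_mul (by positivity),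
    mul_inv_cancel₀ (by positivity), ENNReal.ofReal_one, one_smul]

/-- The measure on the torus which corresponds to Lebesgue measure on the cube of side `a`. -/
def scaledTorusMeasure (d : ℕ) (a : ℝ) : Measure (Torus d) :=
  ENNReal.ofReal (a ^ d) • torusMeasure d

instance (a : ℝ) : IsFiniteMeasure (scaledTorusMeasure d a) :=
  Measure.smul_finite _ ENNReal.ofReal_ne_top

theorem measurePreserving_sheetMap {a : ℝ} (ha : 0 < a) :
    MeasurePreserving (sheetMap (d := d) a) ((scaledTorusMeasure d a).prod Measure.count)
      volume := by
  rw [scaledTorusMeasure, Measure.prod_smul_left]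
  exact (measurePreserving_const_smul ha).comp
    (measurePreserving_rep_add_latticePoint.smul_measure _)

/-- The class modulo `a ℤ^d`, rescaled to the unit torus. -/
def torusClass (a : ℝ) (y : Rd d) : Torus d := fun i => ((a⁻¹ * y i : ℝ) : UnitAddCircle)

theorem measurable_torusClass (a : ℝ) : Measurable (torusClass (d := d) a) :=
  measurable_pi_lambda _ fun i =>
    AddCircle.measurable_mk'.comp ((measurable_coord i).const_mul _)

theorem torusClass_sheetMap {a : ℝ} (ha : a ≠ 0) (x : Torus d) (j : Fin d → ℤ) :
    torusClass a (sheetMap a (x, j)) = x := by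
  funext i
  simp only [torusClass, sheetMap, PiLp.smul_apply, PiLp.add_apply, smul_eq_mul,
    inv_mul_cancel_left₀ ha, latticePoint, AddCircle.coe_add, coe_rep]
  have : ((j i : ℝ) : UnitAddCircle) = 0 :=
    (AddCircle.coe_eq_zero_iff 1).2 ⟨j i, by simp⟩
  rw [this, add_zero]

theorem exists_sheetMap_torusClass {a : ℝ} (ha : a ≠ 0) (y : Rd d) :
    ∃ j : Fin d → ℤ, y = sheetMap a (torusClass a y, j) := by
  have h : ∀ i, ∃ n : ℤ, (n : ℝ) = a⁻¹ * y i - rep (torusClass a y) i := by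
    intro i
    have h1 : ((a⁻¹ * y i - rep (torusClass a y) i : ℝ) : UnitAddCircle) = 0 := by
      rw [AddCircle.coe_sub, coe_rep, torusClass, sub_self]
    obtain ⟨n, hn⟩ := (AddCircle.coe_eq_zero_iff 1).1 h1
    exact ⟨n, by simpa using hn⟩
  choose j hj using h
  refine ⟨j, ?_⟩
  ext i
  simp only [sheetMap, PiLp.smul_apply, PiLp.add_apply, smul_eq_mul, latticePoint, hj]
  field_simp
  ring

/-- A property of almost every point of the torus holds at the class of almost every point of
`ℝ^d`. -/
theorem ae_torusClass {a : ℝ} (ha : 0 < a) {p : Torus d → Prop}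
    (hp : ∀ᵐ x ∂scaledTorusMeasure d a, p x) : ∀ᵐ y : Rd d, p (torusClass a y) := by
  have hq : Measure.QuasiMeasurePreserving (torusClass (d := d) a) volume
      (scaledTorusMeasure d a) := by
    refine ⟨measurable_torusClass a, Measure.AbsolutelyContinuous.mk fun N hN hN0 => ?_⟩
    rw [Measure.map_apply (measurable_torusClass a) hN,
      ← (measurePreserving_sheetMap ha).measure_preimage
        (measurable_torusClass a hN).nullMeasurableSet]
    have : sheetMap a ⁻¹' (torusClass a ⁻¹' N) = N ×ˢ (Set.univ : Set (Fin d → ℤ)) := by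
      ext ⟨x, j⟩
      simp [torusClass_sheetMap ha.ne']
    rw [this, Measure.prod_prod, hN0, zero_mul]
  exact hq.ae hp

theorem sheetMap_mem_box_iff {a : ℝ} (ha : 0 < a) (x : Torus d) (j : Fin d → ℤ) :
    (∀ i, sheetMap a (x, j) i ∈ Set.Ioc (-(a / 2)) (a / 2)) ↔ j = 0 := by
  have h1 : (∀ i, sheetMap a (x, j) i ∈ Set.Ioc (-(a / 2)) (a / 2)) ↔
      rep x + latticePoint j ∈ unitBox d := by
    refine forall_congr' fun i => ?_
    simp only [sheetMap, PiLp.smul_apply, smul_eq_mul, Set.mem_Ioc]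
    rw [← mul_le_mul_iff_right₀ ha (b := (rep x + latticePoint j) i),
      ← mul_lt_mul_iff_right₀ ha (c := (rep x + latticePoint j) i)]
    constructor <;> rintro ⟨h1, h2⟩ <;> constructor <;> linarith
  have h0 : ∀ y : Rd d, y - latticePoint (0 : Fin d → ℤ) = y := fun y => by
    ext i; simp [latticePoint]
  have h2 : boxIndex (rep x + latticePoint j) = j :=
    (boxIndex_eq_iff _ _).2 (by rw [add_sub_cancel_right]; exact rep_mem_unitBox x)
  rw [h1]
  constructor
  · intro h
    rw [← h2]
    exact (boxIndex_eq_iff _ _).2 (by rwa [h0])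
  · rintro rfl
    rw [← h0 (rep x + _), add_sub_cancel_right]
    exact rep_mem_unitBox x

/-- The phase factors of the translates are characters of the torus. -/
theorem mFourier_neg_eq_fourierChar {a : ℝ} (ha : a ≠ 0) (k : Fin d → ℤ) (x : Torus d)
    (j : Fin d → ℤ) :
    UnitAddTorus.mFourier (-k) x =
      Real.fourierChar (-inner ℝ (a⁻¹ • latticePoint k) (sheetMap a (x, j))) := by
  have h1 : x = fun i => (((rep x + latticePoint j) i : ℝ) : UnitAddCircle) := by
    conv_lhs => rw [← torusClass_sheetMap ha x j]
    funext i
    simp only [torusClass, sheetMap, PiLp.smul_apply, smul_eq_mul, inv_mul_cancel_left₀ ha]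
  rw [sheetMap, inner_smul_left, inner_smul_right]
  simp only [conj_trivial, inv_mul_cancel_left₀ ha]
  conv_lhs => rw [h1]
  simp only [UnitAddTorus.mFourier, ContinuousMap.coe_mk, Real.fourierChar_apply,
    fourier_coe_apply]
  rw [← Complex.exp_sum]
  congr 1
  simp only [PiLp.inner_apply, latticePoint, RCLike.inner_apply, conj_trivial, Pi.neg_apply]
  push_cast
  rw [← Finset.sum_neg_distrib, Finset.mul_sum, Finset.sum_mul]
  refine Finset.sum_congr rfl fun i _ => ?_
  ring

/-! ### The Fourier transform of dilated translates in `L²` -/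

section FourierL2

open scoped SchwartzMap

/-- The `L²` Fourier transform is its own transpose against Schwartz functions. -/
theorem integral_fourier_mul_eq (f : L2 d) (χ : 𝓢(Rd d, ℂ)) :
    ∫ x, (𝓕 χ : 𝓢(Rd d, ℂ)) x * f x = ∫ ξ, χ ξ * (𝓕 f : L2 d) ξ := by
  have h := congrArg (fun u => u χ) (Lp.fourier_toTemperedDistribution_eq f)
  simpa using h

theorem ae_eq_of_forall_integral_schwartz_mul_eq {f g : Rd d → ℂ} (hf : MemLp f 2 volume)
    (hg : MemLp g 2 volume)
    (h : ∀ χ : 𝓢(Rd d, ℂ), ∫ x, χ x * f x = ∫ x, χ x * g x) : f =ᵐ[volume] g := by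
  have hker := Lp.ker_toTemperedDistributionCLM_eq_bot (E := Rd d) (F := ℂ) (μ := volume) (p := 2)
  have heq : hf.toLp f = hg.toLp g := by
    refine LinearMap.ker_eq_bot.1 hker ?_
    ext χ
    simp only [ContinuousLinearMap.coe_coe, Lp.toTemperedDistributionCLM_apply,
      Lp.toTemperedDistribution_apply, smul_eq_mul]
    rw [integral_congr_ae (g := fun x => χ x * f x), h χ]
    · refine integral_congr_ae ?_
      filter_upwards [hg.coeFn_toLp] with x hx
      rw [hx]
    · filter_upwards [hf.coeFn_toLp] with x hx
      rw [hx]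
  exact (MemLp.toLp_eq_toLp_iff hf hg).1 heq

theorem memLp_comp_smul {f : Rd d → ℂ} (hf : MemLp f 2 volume) {a : ℝ} (ha : 0 < a) :
    MemLp (fun x => f (a • x)) 2 volume := by
  have hmap := Measure.map_addHaar_smul (volume : Measure (Rd d)) ha.ne'
  have hdil : MemLp f 2 (Measure.map (a • ·) (volume : Measure (Rd d))) := by
    rw [hmap]
    exact hf.smul_measure ENNReal.ofReal_ne_top
  exact hdil.comp_of_map (measurable_const_smul a).aemeasurable

theorem integral_comp_inv_smul_sub {T : ℝ} (hT : 0 < T) (b : Rd d) (F : Rd d → ℂ) :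
    ∫ x, F (T⁻¹ • x - b) = ((T ^ d : ℝ) : ℂ) * ∫ x, F x := by
  rw [Measure.integral_comp_smul volume (fun x => F (x - b)) T⁻¹, finrank_euclideanSpace_fin,
    integral_sub_right_eq_self, abs_of_pos (by positivity), inv_pow, inv_inv, Complex.real_smul]

/-- The Fourier transform of a dilated translate of an `L²` function. It is tested against a
Schwartz function, whose transform can be dilated and translated explicitly. -/
theorem fourier_generator (φ : L2 d) {T : ℝ} (hT : 0 < T) (s : ℝ) (k : Fin d → ℤ) :
    (𝓕 (generator φ hT s k) : L2 d) =ᵐ[volume] fun ξ =>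
      ((T ^ ((d : ℝ) / 2) : ℝ) : ℂ) *
        ((Real.fourierChar (-inner ℝ ((T * s) • latticePoint k) ξ) : ℂ) *
          (𝓕 φ : L2 d) (T • ξ)) := by
  refine ae_eq_of_forall_integral_schwartz_mul_eq (Lp.memLp _) ?_ fun χ => ?_
  · refine MemLp.const_mul ?_ _
    have hdil := memLp_comp_smul (Lp.memLp (𝓕 φ : L2 d)) hT
    refine hdil.of_le_mul (c := 1) ?_ (ae_of_all _ fun ξ => ?_)
    · refine AEStronglyMeasurable.mul (Continuous.aestronglyMeasurable ?_) hdil.1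
      exact continuous_subtype_val.comp (Real.continuous_fourierChar.comp (by fun_prop))
    · rw [norm_mul, Circle.norm_coe]
  set b : Rd d := s • latticePoint k with hb
  -- `η' y = (𝓕 χ) (T (y + b))` and its inverse transform `χ'`
  let η' : 𝓢(Rd d, ℂ) := SchwartzMap.compSubConstCLM ℂ (-b)
    (SchwartzMap.compCLMOfContinuousLinearEquiv ℂ
      (ContinuousLinearEquiv.smulLeft (Units.mk0 T hT.ne') : Rd d ≃L[ℝ] Rd d) (𝓕 χ))
  have hη' : ∀ y, η' y = (𝓕 χ : 𝓢(Rd d, ℂ)) (T • (y + b)) := fun y => by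
    simp [η', Units.smul_def]
  let χ' : 𝓢(Rd d, ℂ) := 𝓕⁻ η'
  have hχ'1 : (𝓕 χ' : 𝓢(Rd d, ℂ)) = η' := fourier_fourierInv_eq η'
  have hχ' : ∀ ξ, ((T ^ d : ℝ) : ℂ) * χ' ξ =
      (Real.fourierChar (-inner ℝ b ξ) : ℂ) * χ (T⁻¹ • ξ) := by
    intro ξ
    have h1 : χ' ξ = ∫ y, (Real.fourierChar (inner ℝ y ξ) : ℂ) * η' y := by
      simp only [χ', SchwartzMap.fourierInv_coe, Real.fourierInv_eq, Circle.smul_def, smul_eq_mul]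
    have h2 : χ (T⁻¹ • ξ) =
        ∫ x, (Real.fourierChar (inner ℝ x (T⁻¹ • ξ)) : ℂ) * (𝓕 χ : 𝓢(Rd d, ℂ)) x := by
      conv_lhs => rw [← fourierInv_fourier_eq (F := 𝓢(Rd d, ℂ)) χ]
      simp only [SchwartzMap.fourierInv_coe, Real.fourierInv_eq, Circle.smul_def, smul_eq_mul]
    have h3 := integral_comp_inv_smul_sub hT b
      fun y => (Real.fourierChar (inner ℝ y ξ) : ℂ) * η' y
    rw [h1, ← h3, h2, ← integral_const_mul]
    congr with x
    rw [hη', sub_add_cancel, smul_inv_smul₀ hT.ne', inner_sub_left, sub_eq_add_neg,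
      AddChar.map_add_eq_mul, inner_smul_left, inner_smul_right]
    simp only [conj_trivial, Circle.coe_mul]
    ring
  have hTpow : ((T ^ (-(d : ℝ) / 2) : ℝ) : ℂ) * ((T ^ d : ℝ) : ℂ) =
      ((T ^ ((d : ℝ) / 2) : ℝ) : ℂ) := by
    rw [← Complex.ofReal_mul, ← Real.rpow_natCast, ← Real.rpow_add hT]
    congr 2
    ring
  calc ∫ ξ, χ ξ * (𝓕 (generator φ hT s k) : L2 d) ξ
      = ∫ x, (𝓕 χ : 𝓢(Rd d, ℂ)) x * generator φ hT s k x := (integral_fourier_mul_eq _ _).symm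
    _ = ∫ x, ((T ^ (-(d : ℝ) / 2) : ℝ) : ℂ) *
          (η' (T⁻¹ • x - b) * φ (T⁻¹ • x - b)) := by
        refine integral_congr_ae ?_
        filter_upwards [(memLp_generatorFun φ hT s k).coeFn_toLp] with x hx
        rw [generator, hx, generatorFun, hη', sub_add_cancel, smul_inv_smul₀ hT.ne']
        ring
    _ = ((T ^ ((d : ℝ) / 2) : ℝ) : ℂ) * ∫ y, η' y * φ y := by
        rw [integral_const_mul, integral_comp_inv_smul_sub hT b fun y => η' y * φ y, ← mul_assoc,
          hTpow]
    _ = ((T ^ ((d : ℝ) / 2) : ℝ) : ℂ) * ∫ ξ, χ' ξ * (𝓕 φ : L2 d) ξ := by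
        rw [← integral_fourier_mul_eq, hχ'1]
    _ = ((T ^ ((d : ℝ) / 2) : ℝ) : ℂ) * ∫ ξ, χ ξ *
          ((Real.fourierChar (-inner ℝ ((T * s) • latticePoint k) ξ) : ℂ) *
            (𝓕 φ : L2 d) (T • ξ)) := by
        congr 1
        have h4 := integral_comp_inv_smul_sub hT 0 fun ξ => χ ξ *
          ((Real.fourierChar (-inner ℝ ((T * s) • latticePoint k) ξ) : ℂ) *
            (𝓕 φ : L2 d) (T • ξ))
        have hTd : ((T ^ d : ℝ) : ℂ) ≠ 0 := Complex.ofReal_ne_zero.2 (by positivity)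
        refine mul_left_cancel₀ hTd ?_
        rw [← h4, ← integral_const_mul]
        congr with ξ
        rw [← mul_assoc, hχ', sub_zero, smul_inv_smul₀ hT.ne', inner_smul_right, mul_smul,
          real_inner_smul_left (s • latticePoint k) ξ T, ← hb, inv_mul_cancel_left₀ hT.ne']
        ring
    _ = _ := by
        rw [← integral_const_mul]
        congr with ξ
        ring

/-- A function of the Sobolev space `W_2^r` has a Fourier transform which is square integrable for
the weight `(1 + ‖ω‖²)^r`. -/
theorem MemW.integrable {r : ℝ} {f : L2 d} (hf : MemW r f) :
    Integrable fun ω : Rd d => (1 + ‖ω‖ ^ 2) ^ r * ‖(𝓕 f : L2 d) ω‖ ^ 2 := by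
  obtain ⟨u, hu⟩ := TemperedDistribution.memSobolev_iff_exists_smulLeftCLM_fourier.1 hf
  rw [Lp.fourier_toTemperedDistribution_eq] at hu
  have hgrowth : (fun x : Rd d => (((1 + ‖x‖ ^ 2) ^ (r / 2) : ℝ) : ℂ)).HasTemperateGrowth := by
    fun_prop
  have hcont : Continuous fun x : Rd d => (((1 + ‖x‖ ^ 2) ^ (r / 2) : ℝ) : ℂ) :=
    hgrowth.1.continuous
  have hloc : LocallyIntegrable
      (fun x : Rd d => (((1 + ‖x‖ ^ 2) ^ (r / 2) : ℝ) : ℂ) * (𝓕 f : L2 d) x) volume := by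
    have h1 := (Lp.memLp (𝓕 f : L2 d)).locallyIntegrable (by norm_num)
    rw [← locallyIntegrableOn_univ] at h1 ⊢
    exact h1.continuousOn_mul hcont.continuousOn isOpen_univ.isLocallyClosed
  have huloc := (Lp.memLp u).locallyIntegrable (by norm_num)
  have hae : (fun x : Rd d => (((1 + ‖x‖ ^ 2) ^ (r / 2) : ℝ) : ℂ) * (𝓕 f : L2 d) x)
      =ᵐ[volume] u := by
    refine ae_eq_of_integral_contDiff_smul_eq hloc huloc fun g hg hgc => ?_
    have hg1 : HasCompactSupport (Complex.ofRealCLM ∘ g) := hgc.comp_left rfl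
    have hg2 : ContDiff ℝ ((⊤ : ℕ∞) : WithTop ℕ∞) (Complex.ofRealCLM ∘ g) := by fun_prop
    have h := congrArg (fun v => v (hg1.toSchwartzMap hg2)) hu
    simp only [TemperedDistribution.smulLeftCLM_apply_apply, Lp.toTemperedDistribution_apply,
      SchwartzMap.smulLeftCLM_apply hgrowth] at h
    convert h using 1
    · congr with x
      simp [mul_assoc, mul_left_comm]
    · rfl
  refine (integrable_norm_sq_coeFn u).congr ?_
  filter_upwards [hae] with x hx
  rw [← hx, norm_mul, mul_pow, Complex.norm_real, Real.norm_of_nonneg (by positivity),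
    ← Real.rpow_mul_natCast (by positivity)]
  norm_num

end FourierL2

/-! ### Transport of the shift-invariant space to the torus -/

section Transport

/-- A linear isometry intertwines the projections onto the closed spans of a family and of its
image. -/
theorem starProjection_span_linearIsometry {K H H' : Type*} [NormedAddCommGroup H]
    [InnerProductSpace ℂ H] [CompleteSpace H] [NormedAddCommGroup H'] [InnerProductSpace ℂ H']
    [CompleteSpace H'] (U : H →ₗᵢ[ℂ] H') (v : K → H) (f : H) :
    (Submodule.span ℂ (Set.range fun k => U (v k))).topologicalClosure.starProjection (U f) =
      U ((Submodule.span ℂ (Set.range v)).topologicalClosure.starProjection f) := by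
  have hmap : Submodule.span ℂ (Set.range fun k => U (v k)) =
      (Submodule.span ℂ (Set.range v)).map U.toLinearMap := by
    rw [Submodule.map_span, ← Set.range_comp]; rfl
  refine Submodule.eq_starProjection_of_mem_orthogonal ?_ ?_
  · rw [hmap]
    have h := Submodule.starProjection_apply_mem
      (Submodule.span ℂ (Set.range v)).topologicalClosure f
    exact image_closure_subset_closure_image U.continuous ⟨_, h, rfl⟩
  · rw [Submodule.orthogonal_closure, hmap, Submodule.mem_orthogonal, ← map_sub]
    rintro _ ⟨u, hu, rfl⟩
    have h := Submodule.sub_starProjection_mem_orthogonal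
      (K := (Submodule.span ℂ (Set.range v)).topologicalClosure) f
    have h2 := (Submodule.mem_orthogonal _ _).1 h u (Submodule.le_topologicalClosure _ hu)
    exact (U.inner_map_map _ _).trans h2

/-- The `L²` Fourier transform read in the sheets over the torus:
`f ↦ ((x, j) ↦ (𝓕 f) (a (rep x + j)))`. -/
def fourierSheets (d : ℕ) {a : ℝ} (ha : 0 < a) :
    L2 d →ₗᵢ[ℂ] Lp ℂ 2 ((scaledTorusMeasure d a).prod (Measure.count : Measure (Fin d → ℤ))) :=
  (Lp.compMeasurePreservingₗᵢ ℂ (sheetMap a) (measurePreserving_sheetMap ha)).comp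
    (Lp.fourierTransformₗᵢ (Rd d) ℂ).toLinearIsometry

theorem coeFn_fourierSheets {a : ℝ} (ha : 0 < a) (f : L2 d) :
    fourierSheets d ha f =ᵐ[(scaledTorusMeasure d a).prod Measure.count]
      fun y => (𝓕 f : L2 d) (sheetMap a y) :=
  Lp.coeFn_compMeasurePreserving _ (measurePreserving_sheetMap ha)

theorem ae_sheet {a : ℝ} (ha : 0 < a) {p : Rd d → Prop} (hp : ∀ᵐ ω, p ω) :
    ∀ᵐ y ∂(scaledTorusMeasure d a).prod (Measure.count : Measure (Fin d → ℤ)),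
      p (sheetMap a y) :=
  (measurePreserving_sheetMap ha).quasiMeasurePreserving.ae hp

variable (φ : L2 d) {T s : ℝ} (hT : 0 < T) (hs : 0 < s)

theorem fourierSheets_generator_zero {a : ℝ} (ha : 0 < a) :
    fourierSheets d ha (generator φ hT s 0) =ᵐ[(scaledTorusMeasure d a).prod Measure.count]
      fun y => ((T ^ ((d : ℝ) / 2) : ℝ) : ℂ) * (𝓕 φ : L2 d) (T • sheetMap a y) := by
  have h0 : latticePoint (0 : Fin d → ℤ) = 0 := by ext i; simp [latticePoint]
  filter_upwards [coeFn_fourierSheets ha (generator φ hT s 0),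
    ae_sheet ha (fourier_generator φ hT s 0)] with y h1 h2
  rw [h1, h2, h0, smul_zero, inner_zero_left, neg_zero, AddChar.map_zero_eq_one, Circle.coe_one,
    one_mul]

theorem fourierSheets_generator {a : ℝ} (ha : 0 < a) (hats : a⁻¹ = T * s) (k : Fin d → ℤ) :
    fourierSheets d ha (generator φ hT s k) =ᵐ[(scaledTorusMeasure d a).prod Measure.count]
      fun y => UnitAddTorus.mFourier (-k) y.1 * fourierSheets d ha (generator φ hT s 0) y := by
  filter_upwards [coeFn_fourierSheets ha (generator φ hT s k),
    ae_sheet ha (fourier_generator φ hT s k), fourierSheets_generator_zero φ hT ha]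
    with y h1 h2 h3
  rw [h1, h2, h3, mFourier_neg_eq_fourierChar ha.ne' k y.1 y.2, hats]
  ring

theorem span_mFourier_neg_closure_eq_top :
    (Submodule.span ℂ (Set.range fun k : Fin d → ℤ =>
      UnitAddTorus.mFourier (-k))).topologicalClosure = ⊤ := by
  rw [← UnitAddTorus.span_mFourier_closure_eq_top]
  congr 2
  exact (Equiv.neg (Fin d → ℤ)).surjective.range_comp UnitAddTorus.mFourier

theorem integral_norm_sq_linearCombination_mFourier (c : (Fin d → ℤ) →₀ ℂ) :
    ∫ x, ‖(Finsupp.linearCombination ℂ (fun k : Fin d → ℤ => UnitAddTorus.mFourier (-k)) c) x‖ ^ 2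
      ∂torusMeasure d = ∑ k ∈ c.support, ‖c k‖ ^ 2 := by
  have horth : Orthonormal ℂ fun k : Fin d → ℤ =>
      ContinuousMap.toLp (E := ℂ) 2 (torusMeasure d) ℂ (UnitAddTorus.mFourier (-k)) := by
    have h : Orthonormal ℂ fun k : Fin d → ℤ =>
        ContinuousMap.toLp (E := ℂ) 2 (torusMeasure d) ℂ (UnitAddTorus.mFourier k) :=
      UnitAddTorus.orthonormal_mFourier
    exact h.comp Neg.neg neg_injective
  set p := Finsupp.linearCombination ℂ (fun k : Fin d → ℤ => UnitAddTorus.mFourier (-k)) c with hp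
  have h1 : ContinuousMap.toLp (E := ℂ) 2 (torusMeasure d) ℂ p =
      Finsupp.linearCombination ℂ (fun k : Fin d → ℤ =>
        ContinuousMap.toLp (E := ℂ) 2 (torusMeasure d) ℂ (UnitAddTorus.mFourier (-k))) c := by
    rw [hp, Finsupp.linearCombination_apply, Finsupp.linearCombination_apply, Finsupp.sum,
      Finsupp.sum, map_sum]
    simp only [map_smul]
  have h2 := horth.inner_finsupp_eq_sum_left c c
  rw [← h1, inner_self_eq_norm_sq_to_K, Finsupp.sum] at h2
  have h3 : ‖ContinuousMap.toLp (E := ℂ) 2 (torusMeasure d) ℂ p‖ ^ 2 =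
      ∑ k ∈ c.support, ‖c k‖ ^ 2 := by
    refine Complex.ofReal_injective ?_
    simp only [Complex.ofReal_pow, Complex.ofReal_sum, ← Complex.conj_mul']
    exact (by simpa [Complex.conj_mul'] using h2)
  rw [← h3, norm_sq_eq_integral_coeFn]
  refine integral_congr_ae ?_
  filter_upwards [ContinuousMap.coeFn_toLp (p := 2) (𝕜 := ℂ) (torusMeasure d) p] with x hx
  rw [hx]

theorem IsRieszBasis.exists_lower_bound {ι H : Type*} [NormedAddCommGroup H]
    [InnerProductSpace ℂ H] {v : ι → H} {V : Submodule ℂ H} (h : IsRieszBasis v V) :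
    ∃ A : ℝ, 0 < A ∧ ∀ c : ι →₀ ℂ,
      A * ∑ k ∈ c.support, ‖c k‖ ^ 2 ≤ ‖Finsupp.linearCombination ℂ v c‖ ^ 2 := by
  obtain ⟨-, A, B, hA, -, hAB⟩ := h
  refine ⟨A, hA, fun c => ?_⟩
  have hzero : ∀ k ∉ c.support, c k = 0 := fun k hk => Finsupp.notMem_support_iff.1 hk
  have hmem : Memℓp (fun k => c k) 2 := memℓp_gen <|
    summable_of_ne_finset_zero (s := c.support) fun k hk => by simp [hzero k hk]
  have h1 := (hAB ⟨_, hmem⟩).2.1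
  have h2 := lp.norm_rpow_eq_tsum (p := 2) (by norm_num) (⟨_, hmem⟩ : lp (fun _ : ι => ℂ) 2)
  simp only [ENNReal.toReal_ofNat, Real.rpow_ofNat] at h2
  rw [h2] at h1
  change A * ∑' k, ‖c k‖ ^ 2 ≤ ‖∑' k, c k • v k‖ ^ 2 at h1
  rwa [tsum_eq_sum (s := c.support) fun k hk => by simp [hzero k hk],
    tsum_eq_sum (s := c.support) fun k hk => by simp [hzero k hk]] at h1

/-- Positivity of the fibre norms of the generator, from the lower Riesz bound. -/
theorem ae_pos_tsum_norm_sq_fourierSheets {a : ℝ} (ha : 0 < a) (hats : a⁻¹ = T * s)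
    (hφ : IsRieszBasis (generator φ hT s) (shiftSpace φ hT s)) :
    ∀ᵐ x ∂scaledTorusMeasure d a,
      0 < ∑' j, ‖fourierSheets d ha (generator φ hT s 0) (x, j)‖ ^ 2 := by
  obtain ⟨A, hA, hbound⟩ := hφ.exists_lower_bound
  have had : 0 < a ^ d := by positivity
  have h := ae_le_tsum_norm_sq_fibre (A := A / a ^ d) span_mFourier_neg_closure_eq_top
    (v := fun k => fourierSheets d ha (generator φ hT s k))
    (fourierSheets_generator φ hT ha hats) fun c => by
      have hint : ∫ x, ‖(Finsupp.linearCombination ℂ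
          (fun k : Fin d → ℤ => UnitAddTorus.mFourier (-k)) c) x‖ ^ 2 ∂scaledTorusMeasure d a =
          a ^ d * ∑ k ∈ c.support, ‖c k‖ ^ 2 := by
        rw [scaledTorusMeasure, integral_smul_measure, ENNReal.toReal_ofReal had.le,
          integral_norm_sq_linearCombination_mFourier, smul_eq_mul]
      rw [hint, ← mul_assoc, div_mul_cancel₀ _ had.ne']
      refine (hbound c).trans (le_of_eq ?_)
      rw [← (fourierSheets d ha).norm_map, Finsupp.linearCombination_apply,
        Finsupp.linearCombination_apply, Finsupp.sum, Finsupp.sum, map_sum]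
      simp only [map_smul]
  filter_upwards [h] with x hx
  exact (by positivity : 0 < A / a ^ d).trans_le hx

/-- The squared constant of the unitary Fourier transform in angular frequency. -/
theorem fourierL2_norm_sq (f : L2 d) (ξ : Rd d) :
    ‖fourierL2 f ξ‖ ^ 2 = ((2 * π) ^ d)⁻¹ * ‖(𝓕 f : L2 d) ((2 * π)⁻¹ • ξ)‖ ^ 2 := by
  rw [fourierL2, norm_mul, mul_pow, Complex.norm_real, Real.norm_of_nonneg (by positivity),
    ← Real.rpow_mul_natCast (by positivity)]
  congr 1
  rw [show -(d : ℝ) / 2 * ((2 : ℕ) : ℝ) = -(d : ℝ) by push_cast; ring,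
    Real.rpow_neg (by positivity), Real.rpow_natCast]

include hT hs in
theorem fourierL2_norm_sq_add_latticePoint {a : ℝ} (hats : a⁻¹ = T * s) (x : Torus d)
    (j k : Fin d → ℤ) :
    ‖fourierL2 φ ((2 * π * T) • sheetMap a (x, j) + (2 * π / s) • latticePoint k)‖ ^ 2 =
      ((2 * π) ^ d)⁻¹ * ‖(𝓕 φ : L2 d) (T • sheetMap a (x, j + k))‖ ^ 2 := by
  rw [fourierL2_norm_sq]
  congr 4
  have ha : a = (T * s)⁻¹ := by rw [← hats, inv_inv]
  ext i
  simp only [sheetMap, latticePoint, PiLp.smul_apply, PiLp.add_apply, smul_eq_mul, ha,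
    Pi.add_apply, Int.cast_add]
  field_simp
  ring

include hs in
/-- The fibre norms of the generator are the periodization of `|φ̂|²`, up to a constant. -/
theorem ae_periodization_sheet {a : ℝ} (ha : 0 < a) (hats : a⁻¹ = T * s) :
    ∀ᵐ x ∂scaledTorusMeasure d a, ∀ j : Fin d → ℤ,
      (∀ i, ‖fourierSheets d ha (generator φ hT s 0) (x, i)‖ ^ 2 =
        (2 * π * T) ^ d * ‖fourierL2 φ ((2 * π * T) • sheetMap a (x, i))‖ ^ 2) ∧
      Summable (fun k : Fin d → ℤ =>
        ‖fourierL2 φ ((2 * π * T) • sheetMap a (x, j) + (2 * π / s) • latticePoint k)‖ ^ 2) ∧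
      ∑' i, ‖fourierSheets d ha (generator φ hT s 0) (x, i)‖ ^ 2 =
        (2 * π * T) ^ d * periodization φ s ((2 * π * T) • sheetMap a (x, j)) := by
  have h0 : latticePoint (0 : Fin d → ℤ) = 0 := by ext i; simp [latticePoint]
  filter_upwards [Measure.ae_ae_of_ae_prod (fourierSheets_generator_zero φ hT ha),
    ae_summable_norm_sq_fibre (fourierSheets d ha (generator φ hT s 0))] with x h1 h2 j
  rw [Measure.ae_count_iff] at h1
  have hval : ∀ i, ‖fourierSheets d ha (generator φ hT s 0) (x, i)‖ ^ 2 =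
      T ^ d * ‖(𝓕 φ : L2 d) (T • sheetMap a (x, i))‖ ^ 2 := by
    intro i
    rw [h1, norm_mul, mul_pow, Complex.norm_real, Real.norm_of_nonneg (by positivity),
      ← Real.rpow_mul_natCast hT.le, ← Real.rpow_natCast T d]
    congr 2
    push_cast
    ring
  have hterm : ∀ k : Fin d → ℤ,
      (2 * π * T) ^ d * ‖fourierL2 φ ((2 * π * T) • sheetMap a (x, j) +
        (2 * π / s) • latticePoint k)‖ ^ 2 =
      ‖fourierSheets d ha (generator φ hT s 0) (x, j + k)‖ ^ 2 := by
    intro k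
    rw [fourierL2_norm_sq_add_latticePoint φ hT hs hats, hval, mul_pow]
    field_simp
  have hsum : Summable fun k : Fin d → ℤ => (2 * π * T) ^ d *
      ‖fourierL2 φ ((2 * π * T) • sheetMap a (x, j) + (2 * π / s) • latticePoint k)‖ ^ 2 := by
    simp only [hterm]
    exact h2.comp_injective (add_right_injective j)
  refine ⟨fun i => ?_, ?_, ?_⟩
  · have h := fourierL2_norm_sq_add_latticePoint φ hT hs hats x i 0
    rw [h0, smul_zero, add_zero, add_zero] at h
    rw [h, hval, mul_pow]
    field_simp
  · exact (summable_mul_left_iff (by positivity : (2 * π * T) ^ d ≠ 0)).1 hsum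
  · rw [periodization, ← tsum_mul_left]
    simp only [hterm]
    exact ((Equiv.addLeft j).tsum_eq
      fun i => ‖fourierSheets d ha (generator φ hT s 0) (x, i)‖ ^ 2).symm

theorem ae_comp_smul {c : ℝ} (hc : 0 < c) {p : Rd d → Prop} (hp : ∀ᵐ y, p y) :
    ∀ᵐ y : Rd d, p (c • y) := by
  have h := (measurePreserving_const_smul (d := d) hc).quasiMeasurePreserving.ae hp
  rwa [Measure.ae_ennreal_smul_measure_iff (by simpa using pow_pos hc d)] at h

include hs in
/-- The periodization of `|φ̂|²` converges to a positive value almost everywhere. -/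
theorem ae_summable_and_periodization_pos
    (hφ : IsRieszBasis (generator φ hT s) (shiftSpace φ hT s)) :
    ∀ᵐ η : Rd d, Summable (fun k : Fin d → ℤ =>
        ‖fourierL2 φ (η + (2 * π / s) • latticePoint k)‖ ^ 2) ∧ 0 < periodization φ s η := by
  have ha : 0 < (T * s)⁻¹ := by positivity
  have hats : ((T * s)⁻¹)⁻¹ = T * s := inv_inv _
  have hx : ∀ᵐ x ∂scaledTorusMeasure d (T * s)⁻¹, ∀ j : Fin d → ℤ,
      Summable (fun k : Fin d → ℤ => ‖fourierL2 φ ((2 * π * T) • sheetMap (T * s)⁻¹ (x, j) +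
        (2 * π / s) • latticePoint k)‖ ^ 2) ∧
      0 < periodization φ s ((2 * π * T) • sheetMap (T * s)⁻¹ (x, j)) := by
    filter_upwards [ae_periodization_sheet φ hT hs ha hats,
      ae_pos_tsum_norm_sq_fourierSheets φ hT ha hats hφ] with x h1 h2 j
    refine ⟨(h1 j).2.1, ?_⟩
    rw [(h1 j).2.2] at h2
    exact pos_of_mul_pos_right h2 (by positivity : (0:ℝ) ≤ (2 * π * T) ^ d)
  have hc : 0 < (2 * π * T)⁻¹ := by positivity
  filter_upwards [ae_comp_smul hc (ae_torusClass ha hx)] with η h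
  obtain ⟨j, hj⟩ := exists_sheetMap_torusClass ha.ne' ((2 * π * T)⁻¹ • η)
  have h' := h j
  rwa [← hj, smul_inv_smul₀ (by positivity)] at h'

end Transport

/-! ### The low-frequency part -/

section LowPass

/-- The half-open frequency cube `(-a/2, a/2]^d`. -/
def centralCube (d : ℕ) (a : ℝ) : Set (Rd d) := {ω | ∀ i, ω i ∈ Set.Ioc (-(a / 2)) (a / 2)}

theorem measurableSet_centralCube (a : ℝ) : MeasurableSet (centralCube d a) := by
  rw [centralCube, Set.ofPred_forall]
  exact MeasurableSet.iInter fun i => measurable_coord i measurableSet_Ioc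

theorem measurableSet_cube (a : ℝ) : MeasurableSet (cube d a) := by
  rw [cube, Set.ofPred_forall]
  exact MeasurableSet.iInter fun i => measurable_coord i measurableSet_Icc

/-- The half-open and the closed cube agree up to a null set. -/
theorem centralCube_ae_eq_cube (a : ℝ) : centralCube d a =ᵐ[volume] cube d (a / 2) := by
  have h := (PiLp.volume_preserving_ofLp (Fin d)).quasiMeasurePreserving.preimage_ae_eq
    (Measure.univ_pi_Ioc_ae_eq_Icc (μ := fun _ : Fin d => (volume : Measure ℝ))
      (f := fun _ => -(a / 2)) (g := fun _ => a / 2))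
  have h1 : centralCube d a = WithLp.ofLp ⁻¹'
      (Set.univ.pi fun _ : Fin d => Set.Ioc (-(a / 2)) (a / 2)) := by
    ext ω; simp [centralCube]
  have h2 : cube d (a / 2) = WithLp.ofLp ⁻¹'
      (Set.Icc (fun _ : Fin d => -(a / 2)) fun _ => a / 2) := by
    ext ω; simp [cube, Pi.le_def, forall_and]
  rw [h1, h2]
  exact h

/-- The central sheet parametrizes the central frequency cube. -/
theorem measurePreserving_centralSheet {a : ℝ} (ha : 0 < a) :
    MeasurePreserving (fun x : Torus d => sheetMap a (x, 0)) (scaledTorusMeasure d a)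
      (volume.restrict (centralCube d a)) := by
  have h1 := (measurePreserving_sheetMap (d := d) ha).restrict_preimage
    (measurableSet_centralCube a)
  have hpre : sheetMap a ⁻¹' centralCube d a =
      (Set.univ : Set (Torus d)) ×ˢ ({0} : Set (Fin d → ℤ)) := by
    ext ⟨x, j⟩
    simpa [centralCube] using sheetMap_mem_box_iff ha x j
  rw [hpre, ← Measure.prod_restrict, Measure.restrict_univ, Measure.restrict_singleton,
    Measure.count_singleton, one_smul, Measure.prod_dirac] at h1
  exact h1.comp ⟨measurable_prodMk_right, rfl⟩

/-- The part of `f` whose frequencies lie in the half-open cube `(-a/2, a/2]^d`. -/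
def lowPass (a : ℝ) (f : L2 d) : L2 d :=
  𝓕⁻ (((Lp.memLp (𝓕 f : L2 d)).indicator (measurableSet_centralCube a)).toLp _)

theorem fourier_lowPass (a : ℝ) (f : L2 d) :
    (𝓕 (lowPass a f) : L2 d) =ᵐ[volume] (centralCube d a).indicator (𝓕 f : L2 d) := by
  rw [lowPass, fourier_fourierInv_eq]
  exact MemLp.coeFn_toLp _

theorem norm_sq_sub_lowPass (a : ℝ) (f : L2 d) :
    ‖f - lowPass a f‖ ^ 2 = ∫ ω in (centralCube d a)ᶜ, ‖(𝓕 f : L2 d) ω‖ ^ 2 := by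
  have hsub : (𝓕 (f - lowPass a f) : L2 d) = 𝓕 f - 𝓕 (lowPass a f) :=
    (Lp.fourierTransformₗᵢ (Rd d) ℂ).map_sub _ _
  rw [← Lp.norm_fourier_eq, hsub, norm_sq_eq_integral_coeFn,
    ← integral_indicator (measurableSet_centralCube a).compl]
  refine integral_congr_ae ?_
  filter_upwards [Lp.coeFn_sub (𝓕 f : L2 d) (𝓕 (lowPass a f)), fourier_lowPass a f] with ω h1 h2
  rw [h1, Pi.sub_apply, h2]
  by_cases hω : ω ∈ centralCube d a <;> simp [hω]

theorem measurable_fourierL2 (f : L2 d) : Measurable (fourierL2 f) :=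
  ((Lp.stronglyMeasurable (𝓕 f : L2 d)).measurable.comp
    (measurable_const_smul ((2 * π)⁻¹))).const_mul _

theorem measurable_errorKernel (φ : L2 d) (s : ℝ) : Measurable (errorKernel φ s) := by
  have h : Measurable (periodization φ s) := Measurable.tsum fun k =>
    ((measurable_fourierL2 φ).comp (measurable_id.add_const _)).norm.pow_const 2
  exact measurable_const.sub (((measurable_fourierL2 φ).norm.pow_const 2).div h)

theorem integrable_norm_sq_fourierL2 (f : L2 d) :
    Integrable fun ξ : Rd d => ‖fourierL2 f ξ‖ ^ 2 := by
  simp only [fourierL2_norm_sq]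
  exact ((integrable_comp_smul_iff volume (fun ω : Rd d => ‖(𝓕 f : L2 d) ω‖ ^ 2)
    (by positivity : (2 * π)⁻¹ ≠ 0)).2 (integrable_norm_sq_coeFn _)).const_mul _

variable (φ : L2 d) {T s : ℝ} (hT : 0 < T) (hs : 0 < s)

include hs in
theorem ae_errorKernel_mem_Icc (hφ : IsRieszBasis (generator φ hT s) (shiftSpace φ hT s)) :
    ∀ᵐ η : Rd d, errorKernel φ s η ∈ Set.Icc 0 1 := by
  have h0 : latticePoint (0 : Fin d → ℤ) = 0 := by ext i; simp [latticePoint]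
  filter_upwards [ae_summable_and_periodization_pos φ hT hs hφ] with η ⟨h1, h2⟩
  have hle : ‖fourierL2 φ η‖ ^ 2 ≤ periodization φ s η := by
    have := h1.le_tsum 0 fun _ _ => by positivity
    rwa [h0, smul_zero, add_zero] at this
  have h3 : ‖fourierL2 φ η‖ ^ 2 / periodization φ s η ≤ 1 := div_le_one_of_le₀ hle h2.le
  have h4 : 0 ≤ ‖fourierL2 φ η‖ ^ 2 / periodization φ s η := by positivity
  rw [errorKernel]
  constructor <;> linarith

include hs in
theorem integrable_norm_sq_mul_errorKernel
    (hφ : IsRieszBasis (generator φ hT s) (shiftSpace φ hT s)) (f : L2 d) :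
    Integrable fun ξ : Rd d => ‖fourierL2 f ξ‖ ^ 2 * errorKernel φ s (T • ξ) := by
  refine (integrable_norm_sq_fourierL2 f).mul_bdd (c := 1) ?_ ?_
  · exact ((measurable_errorKernel φ s).comp (measurable_const_smul T)).aestronglyMeasurable
  · filter_upwards [ae_comp_smul hT (ae_errorKernel_mem_Icc φ hT hs hφ)] with ξ h
    rw [Real.norm_of_nonneg h.1]
    exact h.2

include hs in
/-- The error of the projection of the low-frequency part: its only sheet over the torus is the
central one, so that the error formula for functions on a single sheet applies. -/
theorem norm_sq_proj_lowPass_sub (hφ : IsRieszBasis (generator φ hT s) (shiftSpace φ hT s))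
    (f : L2 d) :
    ‖proj φ hT s (lowPass (T * s)⁻¹ f) - lowPass (T * s)⁻¹ f‖ ^ 2 =
      ∫ ω in centralCube d (T * s)⁻¹,
        ‖(𝓕 f : L2 d) ω‖ ^ 2 * errorKernel φ s ((2 * π * T) • ω) := by
  have ha : 0 < (T * s)⁻¹ := by positivity
  have hats : ((T * s)⁻¹)⁻¹ = T * s := inv_inv _
  set a := (T * s)⁻¹ with hadef
  set U := fourierSheets d ha with hU
  set g := U (lowPass a f) with hg
  have hgval : ∀ᵐ x ∂scaledTorusMeasure d a, ∀ j : Fin d → ℤ,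
      g (x, j) = (centralCube d a).indicator (𝓕 f : L2 d) (sheetMap a (x, j)) := by
    have h : ∀ᵐ y ∂(scaledTorusMeasure d a).prod (Measure.count : Measure (Fin d → ℤ)),
        g y = (centralCube d a).indicator (𝓕 f : L2 d) (sheetMap a y) := by
      filter_upwards [coeFn_fourierSheets ha (lowPass a f), ae_sheet ha (fourier_lowPass a f)]
        with y h1 h2
      rw [hg, h1, h2]
    filter_upwards [Measure.ae_ae_of_ae_prod h] with x hx
    exact Measure.ae_count_iff.1 hx
  have hsupp : ∀ᵐ x ∂scaledTorusMeasure d a, ∀ j ≠ 0, g (x, j) = 0 := by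
    filter_upwards [hgval] with x hx j hj
    rw [hx, Set.indicator_of_notMem]
    exact fun h => hj ((sheetMap_mem_box_iff ha x j).1 h)
  have hpos := ae_pos_tsum_norm_sq_fourierSheets φ hT ha hats hφ
  have hmain := norm_sq_starProjection_sub_eq span_mFourier_neg_closure_eq_top
    (v := fun k => U (generator φ hT s k)) (fourierSheets_generator φ hT ha hats) 0 hsupp hpos
  have hproj : ‖proj φ hT s (lowPass a f) - lowPass a f‖ =
      ‖(Submodule.span ℂ (Set.range fun k =>
        U (generator φ hT s k))).topologicalClosure.starProjection g - g‖ := by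
    rw [hg, starProjection_span_linearIsometry, ← map_sub, U.norm_map, proj]
  rw [hproj, hmain, ← (measurePreserving_centralSheet ha).map_eq, integral_map]
  · refine integral_congr_ae ?_
    filter_upwards [hgval, ae_periodization_sheet φ hT hs ha hats] with x h1 h2
    have hmem : sheetMap a (x, 0) ∈ centralCube d a := (sheetMap_mem_box_iff ha x 0).2 rfl
    rw [h1, Set.indicator_of_mem hmem, (h2 0).1, (h2 0).2.2, errorKernel,
      mul_div_mul_left _ _ (by positivity)]
  · exact (measurePreserving_centralSheet ha).measurable.aemeasurable
  · refine Measurable.aestronglyMeasurable ?_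
    exact ((Lp.stronglyMeasurable (𝓕 f : L2 d)).measurable.norm.pow_const 2).mul
      ((measurable_errorKernel φ s).comp (measurable_const_smul _))

/-- The change of variables `ξ = 2 π ω` between the angular and the ordinary frequency. -/
theorem integral_fourierL2_comp (f : L2 d) (h : Rd d → ℝ) :
    ∫ ξ, h ξ * ‖fourierL2 f ξ‖ ^ 2 = ∫ ω, h ((2 * π) • ω) * ‖(𝓕 f : L2 d) ω‖ ^ 2 := by
  have hpi : (2 * π : ℝ) ≠ 0 := by positivity
  have h1 := Measure.integral_comp_smul volume
    (fun ω : Rd d => h ((2 * π) • ω) * ‖(𝓕 f : L2 d) ω‖ ^ 2) (2 * π)⁻¹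
  simp only [smul_inv_smul₀ hpi, finrank_euclideanSpace_fin] at h1
  have h2 : ∀ ξ, h ξ * ‖fourierL2 f ξ‖ ^ 2 =
      ((2 * π) ^ d)⁻¹ * (h ξ * ‖(𝓕 f : L2 d) ((2 * π)⁻¹ • ξ)‖ ^ 2) := fun ξ => by
    rw [fourierL2_norm_sq]; ring
  simp only [h2]
  rw [integral_const_mul, h1, smul_eq_mul, ← mul_assoc, inv_pow, inv_inv,
    abs_of_pos (by positivity), inv_mul_cancel₀ (by positivity), one_mul]

theorem integral_cube_eq (f : L2 d) (h : Rd d → ℝ) {a b : ℝ} (hab : b = π * a) :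
    ∫ ξ in cube d b, ‖fourierL2 f ξ‖ ^ 2 * h ξ =
      ∫ ω in centralCube d a, ‖(𝓕 f : L2 d) ω‖ ^ 2 * h ((2 * π) • ω) := by
  rw [setIntegral_congr_set (centralCube_ae_eq_cube a), ← integral_indicator (measurableSet_cube _),
    ← integral_indicator (measurableSet_cube _)]
  have h1 := integral_fourierL2_comp f ((cube d b).indicator h)
  have hmem : ∀ ω : Rd d, (2 * π) • ω ∈ cube d b ↔ ω ∈ cube d (a / 2) := by
    intro ω
    refine forall_congr' fun i => ?_
    have hpi : 0 < 2 * π := by positivity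
    simp only [PiLp.smul_apply, smul_eq_mul, Set.mem_Icc, hab]
    rw [show -(π * a) = 2 * π * -(a / 2) by ring, show π * a = 2 * π * (a / 2) by ring,
      mul_le_mul_iff_right₀ hpi, mul_le_mul_iff_right₀ hpi]
  have h2 : ∀ ξ, (cube d b).indicator (fun ξ => ‖fourierL2 f ξ‖ ^ 2 * h ξ) ξ =
      (cube d b).indicator h ξ * ‖fourierL2 f ξ‖ ^ 2 := fun ξ => by
    by_cases hξ : ξ ∈ cube d b <;> simp [hξ, mul_comm]
  have h3 : ∀ ω, (cube d b).indicator h ((2 * π) • ω) * ‖(𝓕 f : L2 d) ω‖ ^ 2 =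
      (cube d (a / 2)).indicator
        (fun ω => ‖(𝓕 f : L2 d) ω‖ ^ 2 * h ((2 * π) • ω)) ω := fun ω => by
    by_cases hω : ω ∈ cube d (a / 2)
    · rw [Set.indicator_of_mem hω, Set.indicator_of_mem ((hmem ω).2 hω), mul_comm]
    · rw [Set.indicator_of_notMem hω, Set.indicator_of_notMem (fun h => hω ((hmem ω).1 h)),
        zero_mul]
  rw [integral_congr_ae (ae_of_all _ h2), h1]
  exact integral_congr_ae (ae_of_all _ h3)

end LowPass

/-! ### The high-frequency part -/

section HighFrequency

/-- The Sobolev weight in angular frequency, which differs from the weight in ordinary frequency by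
a bounded factor. -/
theorem MemW.integrable_two_pi {r : ℝ} (hr : 0 ≤ r) {f : L2 d} (hf : MemW r f) :
    Integrable fun ω : Rd d => (1 + ‖(2 * π) • ω‖ ^ 2) ^ r * ‖(𝓕 f : L2 d) ω‖ ^ 2 := by
  have hpi : 1 ≤ 2 * π := by linarith [Real.pi_gt_three]
  refine (hf.integrable.const_mul (((2 * π) ^ 2) ^ r)).mono' ?_ (ae_of_all _ fun ω => ?_)
  · have : Continuous fun ω : Rd d => (1 + ‖(2 * π) • ω‖ ^ 2) ^ r :=
      Continuous.rpow_const (by fun_prop) fun ω => Or.inl (by positivity)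
    exact this.aestronglyMeasurable.mul ((Lp.aestronglyMeasurable _).norm.pow 2)
  · rw [Real.norm_of_nonneg (by positivity), ← mul_assoc,
      ← Real.mul_rpow (by positivity) (by positivity)]
    gcongr
    rw [norm_smul, Real.norm_of_nonneg (by positivity), mul_pow, mul_add, mul_one]
    gcongr
    exact one_le_pow₀ hpi

theorem le_norm_of_notMem_centralCube {a : ℝ} {ω : Rd d} (h : ω ∉ centralCube d a) :
    a / 2 ≤ ‖ω‖ := by
  by_contra! hlt
  refine h fun i => ?_
  have h1 := (PiLp.norm_apply_le ω i).trans_lt hlt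
  rw [Real.norm_eq_abs, abs_lt] at h1
  exact ⟨h1.1, h1.2.le⟩

/-- Outside the frequency cube the Sobolev weight is at least `(π a)^(2r)`. -/
theorem norm_sub_lowPass_le {a r : ℝ} (ha : 0 < a) (hr : 0 ≤ r) {f : L2 d} (hf : MemW r f) :
    ‖f - lowPass a f‖ ≤ normW r f * ((π * a)⁻¹) ^ r := by
  have hint := hf.integrable_two_pi hr
  have hW : normW r f ^ 2 = ∫ ω : Rd d, (1 + ‖(2 * π) • ω‖ ^ 2) ^ r * ‖(𝓕 f : L2 d) ω‖ ^ 2 := by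
    rw [normW, Real.sq_sqrt (integral_nonneg fun ξ => by positivity),
      integral_fourierL2_comp f fun ξ => (1 + ‖ξ‖ ^ 2) ^ r]
  have hpa : 0 < π * a := by positivity
  refine le_of_sq_le_sq ?_ (by rw [normW]; positivity)
  rw [norm_sq_sub_lowPass, mul_pow, hW, mul_comm, ← integral_const_mul]
  refine (setIntegral_mono_on (g := fun ω => (((π * a)⁻¹) ^ r) ^ 2 *
    ((1 + ‖(2 * π) • ω‖ ^ 2) ^ r * ‖(𝓕 f : L2 d) ω‖ ^ 2)) (integrable_norm_sq_coeFn _).integrableOn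
    (hint.const_mul _).integrableOn (measurableSet_centralCube a).compl fun ω hω => ?_).trans
    (setIntegral_le_integral (hint.const_mul _) (ae_of_all _ fun ω => ?_))
  · rw [← mul_assoc]
    refine le_mul_of_one_le_left (by positivity) ?_
    rw [← Real.rpow_mul_natCast (by positivity), mul_comm r, Real.rpow_mul (by positivity),
      ← Real.mul_rpow (by positivity) (by positivity)]
    refine Real.one_le_rpow ?_ hr
    have h1 := le_norm_of_notMem_centralCube hω
    rw [norm_smul, Real.norm_of_nonneg (by positivity), Real.rpow_natCast, inv_pow,
      inv_mul_eq_div, one_le_div₀ (by positivity)]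
    have h2 : π * a ≤ 2 * π * ‖ω‖ := by nlinarith [Real.pi_pos]
    nlinarith [pow_le_pow_left₀ hpa.le h2 2]
  · simp only [Pi.zero_apply]; positivity

end HighFrequency

/-! ### The lattice sum and the error formula -/

section LatticeSum

theorem latticePoint_injective : Function.Injective (latticePoint (d := d)) := by
  intro j k h
  funext i
  have := congrArg (fun y : Rd d => y i) h
  simpa [latticePoint] using this

theorem summable_latticePoint_norm_rpow {r : ℝ} (hr : (d : ℝ) / 2 < r) :
    Summable fun n : {n : Fin d → ℤ // n ≠ 0} => 1 / ‖latticePoint n.1‖ ^ (2 * r) := by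
  set L : Submodule ℤ (Rd d) :=
    Submodule.span ℤ (Set.range (EuclideanSpace.basisFun (Fin d) ℝ).toBasis) with hL
  have hrank : Module.finrank ℤ L = d := by
    rw [ZLattice.rank ℝ L, finrank_euclideanSpace_fin]
  have hmem : ∀ n : Fin d → ℤ, latticePoint n ∈ L := by
    intro n
    rw [hL, Module.Basis.mem_span_iff_repr_mem]
    intro i
    exact ⟨n i, by simp [latticePoint]⟩
  have h := ZLattice.summable_norm_rpow L (-(2 * r)) (by rw [hrank]; linarith)
  have hinj : Function.Injective fun n : {n : Fin d → ℤ // n ≠ 0} =>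
      (⟨latticePoint n.1, hmem n.1⟩ : L) := fun j k hjk =>
    Subtype.ext (latticePoint_injective (congrArg Subtype.val hjk))
  refine (h.comp_injective hinj).congr fun n => ?_
  simp [Real.rpow_neg]

/-- The lattice sum is at least the contribution `1` of a unit vector. -/
theorem one_le_tsum_latticePoint [NeZero d] {r : ℝ} (hr : (d : ℝ) / 2 < r) :
    1 ≤ ∑' n : {n : Fin d → ℤ // n ≠ 0}, 1 / ‖latticePoint n.1‖ ^ (2 * r) := by
  have hne : (Pi.single 0 1 : Fin d → ℤ) ≠ 0 := by simp
  have h := (summable_latticePoint_norm_rpow hr).le_tsum ⟨_, hne⟩ fun n _ => by positivity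
  have hnorm : ‖latticePoint (Pi.single 0 1 : Fin d → ℤ)‖ = 1 := by
    have : latticePoint (Pi.single 0 1 : Fin d → ℤ) = EuclideanSpace.single 0 (1 : ℝ) := by
      ext i
      simp [latticePoint, Pi.single_apply]
    rw [this]; simp
  simpa [hnorm] using h

theorem norm_proj_sub_le (φ : L2 d) {T : ℝ} (hT : 0 < T) (s : ℝ) (u : L2 d) :
    ‖proj φ hT s u - u‖ ≤ ‖u‖ := by
  have h := Submodule.norm_starProjection_apply_le (shiftSpace φ hT s)ᗮ u
  rwa [Submodule.starProjection_orthogonal', sub_apply,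
    one_apply_eq_self, norm_sub_rev] at h

end LatticeSum

end ShiftInvariant

end

theorem theorem3p3 (d : ℕ) (φ : ShiftInvariant.L2 d) (T s : ℝ) (hT : 0 < T) (hs : 0 < s)
    (hφ : ShiftInvariant.IsRieszBasis (ShiftInvariant.generator φ hT s)
      (ShiftInvariant.shiftSpace φ hT s)) :
    -- the denominator of the error kernel is a convergent series with a positive sum
    (∀ᵐ η : ShiftInvariant.Rd d,
      Summable (fun k : Fin d → ℤ =>
        ‖ShiftInvariant.fourierL2 φ (η + (2 * π / s) • ShiftInvariant.latticePoint k)‖ ^ 2) ∧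
      0 < ShiftInvariant.periodization φ s η) ∧
    ∀ (r : ℝ) (f : ShiftInvariant.L2 d), (d : ℝ) / 2 < r → ShiftInvariant.MemW r f →
      IntegrableOn (fun ξ : ShiftInvariant.Rd d =>
        ‖ShiftInvariant.fourierL2 f ξ‖ ^ 2 * ShiftInvariant.errorKernel φ s (T • ξ))
        (ShiftInvariant.cube d (π / (T * s))) ∧
      Summable (fun n : {n : Fin d → ℤ // n ≠ 0} =>
        1 / ‖ShiftInvariant.latticePoint n.1‖ ^ (2 * r)) ∧
      ∃ R : ℝ,
        ‖ShiftInvariant.proj φ hT s f - f‖ =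
          (∫ ξ in ShiftInvariant.cube d (π / (T * s)),
            ‖ShiftInvariant.fourierL2 f ξ‖ ^ 2 *
              ShiftInvariant.errorKernel φ s (T • ξ)) ^ (1 / 2 : ℝ) + R ∧
        |R| ≤ ShiftInvariant.normW r f * (T * s / π) ^ r *
          √(∑' n : {n : Fin d → ℤ // n ≠ 0},
            1 / ‖ShiftInvariant.latticePoint n.1‖ ^ (2 * r)) := by
  refine ⟨ShiftInvariant.ae_summable_and_periodization_pos φ hT hs hφ, fun r f hr hf =>
    ⟨(ShiftInvariant.integrable_norm_sq_mul_errorKernel φ hT hs hφ f).integrableOn,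
      ShiftInvariant.summable_latticePoint_norm_rpow hr, ?_⟩⟩
  have hr0 : 0 ≤ r := le_trans (by positivity) hr.le
  set a := (T * s)⁻¹ with hadef
  have ha : 0 < a := by positivity
  have hI : (∫ ξ in ShiftInvariant.cube d (π / (T * s)), ‖ShiftInvariant.fourierL2 f ξ‖ ^ 2 *
      ShiftInvariant.errorKernel φ s (T • ξ)) ^ (1 / 2 : ℝ) =
      ‖ShiftInvariant.proj φ hT s (ShiftInvariant.lowPass a f) -
        ShiftInvariant.lowPass a f‖ := by
    rw [ShiftInvariant.integral_cube_eq f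
        (fun ξ => ShiftInvariant.errorKernel φ s (T • ξ)) (div_eq_mul_inv π (T * s)),
      ← Real.sqrt_eq_rpow]
    have h := ShiftInvariant.norm_sq_proj_lowPass_sub φ hT hs hφ f
    simp only [smul_smul, mul_comm T (2 * π)]
    rw [← h, Real.sqrt_sq (norm_nonneg _)]
  refine ⟨‖ShiftInvariant.proj φ hT s f - f‖ -
    ‖ShiftInvariant.proj φ hT s (ShiftInvariant.lowPass a f) - ShiftInvariant.lowPass a f‖,
    by rw [hI]; ring, ?_⟩
  have hR : |‖ShiftInvariant.proj φ hT s f - f‖ -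
      ‖ShiftInvariant.proj φ hT s (ShiftInvariant.lowPass a f) - ShiftInvariant.lowPass a f‖| ≤
      ‖f - ShiftInvariant.lowPass a f‖ := by
    refine (abs_norm_sub_norm_le _ _).trans ?_
    rw [sub_sub_sub_comm, ← map_sub]
    exact ShiftInvariant.norm_proj_sub_le φ hT s _
  refine hR.trans ?_
  have hW0 : 0 ≤ ShiftInvariant.normW r f := Real.sqrt_nonneg _
  rcases Nat.eq_zero_or_pos d with rfl | hd
  · -- in dimension `0` the cube is the whole space and there is no high-frequency part
    have h := ShiftInvariant.norm_sq_sub_lowPass a f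
    have huniv : ShiftInvariant.centralCube 0 a = Set.univ :=
      Set.eq_univ_of_forall fun ω i => i.elim0
    rw [huniv, Set.compl_univ, setIntegral_empty] at h
    rw [pow_eq_zero_iff two_ne_zero |>.1 h]
    positivity
  · have : NeZero d := ⟨hd.ne'⟩
    have h1 := ShiftInvariant.norm_sub_lowPass_le ha hr0 hf
    have h2 : (π * a)⁻¹ = T * s / π := by
      rw [hadef, mul_inv, inv_inv, mul_comm, div_eq_mul_inv]
    rw [h2] at h1
    refine h1.trans (le_mul_of_one_le_right (by positivity) ?_)
    rw [Real.one_le_sqrt]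
    exact ShiftInvariant.one_le_tsum_latticePoint hr
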